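/- Let $f(x)=x^n+a_{n-1}x^{n-1}+\dots+a_0\in\mathbb Z[x]$ be a monic polynomial of degree $n>1$ with complex roots $\alpha_1,\dots,\alpha_n$ (in a fixed numbering). Let $$LR=\Big\{(l_1,\dots,l_{n+1})\in\mathbb Q^{n+1} : \sum_{i=1}^n l_i\alpha_i=l_{n+1}\Big\},\qquad t=\dim_{\mathbb Q}LR\ (\ge 1),$$ and say that $f$ has no non-trivial linear relation among roots if $t=1$. For a prime $p$, the local roots of $f$ at $p$ are the integers $0\le r_1\le\dots\le r_n<p$ with $f(x)\equiv\prod_{i=1}^n(x-r_i)\bmod p$; they are unique if they exist. Let $Spl_X(f)$ be the set of primes $p\le X$ for which they exist. For $\sigma\in S_n$ let $Spl_X(f,\sigma)$ be the set of $p\in Spl_X(f)$ with $\sum_i m_i r_{\sigma(i)}\equiv m \bmod p$ for all $(m_1,\dots,m_n,m)\in LR\cap\mathbb Z^{n+1}$; let $Pr(f,\sigma)=\lim_{X\to\infty}\#Spl_X(f,\sigma)/\#Spl_X(f)$ and $$\mathfrak D(f,\sigma)=\Big\{x\in[0,1]^n : x_1\le\dots\le x_n,\ \sum_i m_i x_{\sigma(i)}\in\mathbb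 Z\ \text{ for all }(m_1,\dots,m_n,m)\in LR\cap\mathbb Z^{n+1}\Big\}.$$ Let $vol$ denote $(n-t)$-dimensional volume in $\mathbb R^n$. Conjecture 2 for $f$ is the following assertion. Let $\sigma\in S_n$ be such that $Pr(f,\sigma)$ exists and is positive. Then for every set $D\subset[0,1)^n$ that is the closure (in $\mathbb R^n$) of its interior and whose boundary satisfies $vol(\partial D\cap\mathfrak D(f,\sigma))=0$, $$\lim_{X\to\infty}\frac{\#\{p\in Spl_X(f,\sigma) : (r_1/p,\dots,r_n/p)\in D\}}{\#Spl_X(f,\sigma)}=\frac{vol(D\cap\mathfrak D(f,\sigma))}{vol(\mathfrak D(f,\sigma))}.$$ **Theorem.** Let $f$ be a monic integral polynomial of degree $n>1$ which has no non-trivial linear relation among roots, and suppose that Conjecture 2 holds for $f$. Then for all $1\le i\le n$ and $0\le a<1$ the limit below exists, and $$(n-1)!\lim_{X\to\infty}\frac{\#\{p\in Spl_X(f) : r_i/p<a\}}{\#Spl_X(f)}=\sum_{\substack{0\le h\le n\\ 1\le l\le n-1}}\ \sum_{k=i}^n(-1)^{h+k+n}\binom nk\sum_{m=1}^{n-1}\binom{k}{n-h-m+l}\binom{n-k}{m-l}\,M(l-ha)^{n-1},$$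 where the binomial coefficient $\binom AB$ is $0$ unless $0\le B\le A$, and $M(x)=\max(x,0)$. -/

import Mathlib

namespace LocalRoots

noncomputable section

open Filter Topology MeasureTheory

/-- The rational vector space of linear relations among `α₁, …, αₙ`: all `(l₁, …, lₙ, l')` in
`ℚⁿ × ℚ` with `∑ lᵢ αᵢ = l'`. -/
def linRel {n : ℕ} (α : Fin n → ℂ) : Submodule ℚ ((Fin n → ℚ) × ℚ) where
  carrier := {l | ∑ i, (l.1 i : ℂ) * α i = (l.2 : ℂ)}
  zero_mem' := by simp
  add_mem' := by
    intro a b ha hb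
    simp only [Set.mem_ofPred_eq] at ha hb ⊢
    simp [add_mul, Finset.sum_add_distrib, ha, hb]
  smul_mem' := by
    intro c a ha
    simp only [Set.mem_ofPred_eq] at ha ⊢
    simp [mul_assoc, ← Finset.mul_sum, ha]

/-- The number `t`, the dimension of the space of linear relations. -/
def relDim {n : ℕ} (α : Fin n → ℂ) : ℕ := Module.finrank ℚ (linRel α)

/-- There is a non-trivial linear relation among the roots when `t > 1`. (For the roots of a monic
integral polynomial the relation `∑ αᵢ = -aₙ₋₁` is always present, so `t ≥ 1`.) -/
def HasNontrivialRel {n : ℕ} (α : Fin n → ℂ) : Prop := 1 < relDim α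

/-- `(m, c)` is an integral vector `(m₁, …, mₙ, c)` in the space of linear relations. -/
def IsIntRel {n : ℕ} (α : Fin n → ℂ) (m : Fin n → ℤ) (c : ℤ) : Prop :=
  ((fun i => (m i : ℚ)), (c : ℚ)) ∈ linRel α

/-- `r₁, …, rₙ` are the local roots of `f` at `p`: `f ≡ ∏ (x - rᵢ) mod p` and
`0 ≤ r₁ ≤ ⋯ ≤ rₙ < p`. They are uniquely determined by `f` and `p` if they exist. -/
def IsLocalRoots {n : ℕ} (f : Polynomial ℤ) (p : ℕ) (r : Fin n → ℕ) : Prop :=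
  f.map (Int.castRingHom (ZMod p)) =
      ∏ i, (Polynomial.X - Polynomial.C ((r i : ℕ) : ZMod p)) ∧
    Monotone r ∧ ∀ i, r i < p

/-- The primes `p ≤ X` such that `f` is fully splitting modulo `p` and such that the local roots
`r₁ ≤ ⋯ ≤ rₙ` of `f` at `p` satisfy the condition `P p r`. -/
def splSetOf (n : ℕ) (f : Polynomial ℤ) (X : ℝ) (P : ℕ → (Fin n → ℕ) → Prop) : Set ℕ :=
  {p | p.Prime ∧ (p : ℝ) ≤ X ∧ ∃ r : Fin n → ℕ, IsLocalRoots f p r ∧ P p r}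

/-- `Spl_X(f)`. -/
def Spl (n : ℕ) (f : Polynomial ℤ) (X : ℝ) : Set ℕ := splSetOf n f X fun _ _ => True

/-- The condition `∑ mᵢ r_{σ(i)} ≡ c mod p` for all integral relations `(m, c)`; equivalently, for
those in a `ℤ`-basis of the lattice of integral relations. -/
def SatisfiesRels {n : ℕ} (α : Fin n → ℂ) (σ : Equiv.Perm (Fin n)) (p : ℕ) (r : Fin n → ℕ) :
    Prop :=
  ∀ (m : Fin n → ℤ) (c : ℤ), IsIntRel α m c → ∑ i, m i * (r (σ i) : ℤ) ≡ c [ZMOD (p : ℤ)]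

/-- `Spl_X(f, σ)`. -/
def SplPerm {n : ℕ} (f : Polynomial ℤ) (α : Fin n → ℂ) (σ : Equiv.Perm (Fin n)) (X : ℝ) : Set ℕ :=
  splSetOf n f X fun p r => SatisfiesRels α σ p r

/-- The point `(r₁/p, …, rₙ/p)` of `ℝⁿ`. -/
def rootPoint {n : ℕ} (p : ℕ) (r : Fin n → ℕ) : EuclideanSpace ℝ (Fin n) :=
  WithLp.toLp 2 fun i => (r i : ℝ) / (p : ℝ)

/-- The primes `p` in `Spl_X(f, σ)` with `(r₁/p, …, rₙ/p) ∈ D`. -/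
def SplPermIn {n : ℕ} (f : Polynomial ℤ) (α : Fin n → ℂ) (σ : Equiv.Perm (Fin n))
    (D : Set (EuclideanSpace ℝ (Fin n))) (X : ℝ) : Set ℕ :=
  splSetOf n f X fun p r => SatisfiesRels α σ p r ∧ rootPoint p r ∈ D

/-- `𝔇(f, σ)`: the points `0 ≤ x₁ ≤ ⋯ ≤ xₙ ≤ 1` with `∑ mᵢ x_{σ(i)} ∈ ℤ` for all integral
relations `(m, c)`. -/
def domain {n : ℕ} (α : Fin n → ℂ) (σ : Equiv.Perm (Fin n)) : Set (EuclideanSpace ℝ (Fin n)) :=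
  {x | (∀ i, 0 ≤ x i ∧ x i ≤ 1) ∧ (∀ i j, i ≤ j → x i ≤ x j) ∧
    ∀ (m : Fin n → ℤ) (c : ℤ), IsIntRel α m c → ∃ k : ℤ, ∑ i, (m i : ℝ) * x (σ i) = (k : ℝ)}

/-- The `(n - t)`-dimensional volume on `ℝⁿ`: the Euclidean Hausdorff measure, which on every
`(n - t)`-dimensional affine subspace is the Lebesgue measure in orthonormal coordinates. -/
def relVol {n : ℕ} (α : Fin n → ℂ) : Measure (EuclideanSpace ℝ (Fin n)) :=
  Measure.euclideanHausdorffMeasure (n - relDim α)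

/-- `Pr(f, σ) > 0`: the density of `Spl(f, σ)` in `Spl(f)` exists and is positive. -/
def PrPos {n : ℕ} (f : Polynomial ℤ) (α : Fin n → ℂ) (σ : Equiv.Perm (Fin n)) : Prop :=
  ∃ c : ℝ, 0 < c ∧ Tendsto
    (fun X : ℝ => ((SplPerm f α σ X).ncard : ℝ) / ((Spl n f X).ncard : ℝ)) atTop (𝓝 c)

/-- The equidistribution conjecture for the polynomial `f` with complex roots `α`: if
`Pr(f, σ) > 0`, then for every `D = closure (interior D) ⊆ [0,1)ⁿ`,
`#{p ∈ Spl_X(f, σ) | (r₁/p, …, rₙ/p) ∈ D} / #Spl_X(f, σ) → vol(D ∩ 𝔇(f, σ)) / vol(𝔇(f, σ))`.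

As usual for equidistribution this is required only of those `D` whose boundary is a null set for
the limiting distribution; over all regular closed sets `D`, with boundaries of positive volume
allowed, the assertion cannot be expected to hold, since `D` could be chosen to avoid all the countably many
points `(r₁/p, …, rₙ/p)`. -/
def EquidistributionConjecture {n : ℕ} (f : Polynomial ℤ) (α : Fin n → ℂ) : Prop :=
  ∀ σ : Equiv.Perm (Fin n), PrPos f α σ →
    ∀ D : Set (EuclideanSpace ℝ (Fin n)),
      D = closure (interior D) → (∀ x ∈ D, ∀ i, 0 ≤ x i ∧ x i < 1) →
      relVol α (frontier D ∩ domain α σ) = 0 →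
      Tendsto
        (fun X : ℝ => ((SplPermIn f α σ D X).ncard : ℝ) / ((SplPerm f α σ X).ncard : ℝ))
        atTop (𝓝 ((relVol α).real (D ∩ domain α σ) / (relVol α).real (domain α σ)))

/-- The primes `p` in `Spl_X(f)` whose `i`-th local root satisfies `rᵢ/p < a`. -/
def SplRootLt (n : ℕ) (f : Polynomial ℤ) (i : Fin n) (a : ℝ) (X : ℝ) : Set ℕ :=
  splSetOf n f X fun p r => (r i : ℝ) / (p : ℝ) < a

/-- The binomial coefficient `A` over `B` for an integer `B`, which vanishes unless
`0 ≤ B ≤ A`. -/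
def binom (A : ℕ) (B : ℤ) : ℝ := if 0 ≤ B then (A.choose B.toNat : ℝ) else 0

/-- The right-hand side: the sum over `0 ≤ h ≤ n`, `1 ≤ l ≤ n - 1`, `i ≤ k ≤ n`, `1 ≤ m ≤ n - 1`
of `(-1)^(h+k+n) C(n,k) C(k, n-h-m+l) C(n-k, m-l) max(l - ha, 0)^(n-1)`. -/
def rootSum (n i : ℕ) (a : ℝ) : ℝ :=
  ∑ h ∈ Finset.range (n + 1), ∑ l ∈ Finset.Icc 1 (n - 1), ∑ k ∈ Finset.Icc i n,
    (-1 : ℝ) ^ (h + k + n) * (n.choose k : ℝ) *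
      (∑ m ∈ Finset.Icc 1 (n - 1),
        binom k ((n : ℤ) - h - m + l) * binom (n - k) ((m : ℤ) - l)) *
      (max ((l : ℝ) - h * a) 0) ^ (n - 1)

end

end LocalRoots

/-! ### Splitting primes and the lattice of relations. -/

namespace LocalRoots

open Polynomial

/-! When `t = 1`, every integral relation is a multiple of `∑ αᵢ = S`, which is symmetric in the
roots and holds modulo `p` for the local roots (`isIntRel_iff`, `satisfiesRels_one`). Hence `Spl(f,
1) = Spl(f)`, and Conjecture 2 with `σ = 1` says that the points `(rᵢ/p)` are equidistributed among
the sorted points of the unit cube with integral coordinate sum. Since the conjecture admits only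
closed sets inside `[0,1)ⁿ`, the set `xᵢ < a` is exhausted by closed boxes for the lower bound, and
its complement for the upper bound (`tendsto_splRootLt`).

The limit is thus a ratio of volumes. For sorted points, `xᵢ < a` means that at least `i`
coordinates lie below `a`. That condition is invariant under permutations, so numerator and
denominator may both be computed without sorting, at the cost of the same factor `n!`
(`sumMeasure_eq_factorial_mul`). What remains is a sum over `k ≥ i` of `C(n,k)` times the volume of
the sections of `[0,a)ᵏ × [a,1)ⁿ⁻ᵏ` by the hyperplanes of coordinate sum `m`.

Such a section volume is an iterated integral of truncated powers. In the group algebra of `ℝ`, each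
integration is multiplication by a difference of two monomials (`integral_truncEval`,
`volume_boxSection`), so the binomial theorem gives the stated sum (`factorial_mul_truncEval`). -/

/-- A variant of Euclid's argument: with `c = g(0) ≠ 0`, the value `g(cDy)` is `c` times an integer
congruent to `1` modulo `D`, and any prime factor of that cofactor is prime to `D`. -/
theorem exists_prime_dvd_eval {g : ℤ[X]} (hg : 0 < g.natDegree) {D : ℤ} (hD : D ≠ 0) :
    ∃ p : ℕ, p.Prime ∧ ¬ (p : ℤ) ∣ D ∧ ∃ m : ℤ, (p : ℤ) ∣ g.eval m := by
  by_cases hc : g.eval 0 = 0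
  · obtain ⟨p, hp, hpp⟩ := Nat.exists_infinite_primes (D.natAbs + 1)
    refine ⟨p, hpp, fun h => ?_, 0, by simp [hc]⟩
    have := Nat.le_of_dvd (Int.natAbs_pos.2 hD) (Int.natCast_dvd.1 h)
    omega
  · set c := g.eval 0 with hcdef
    have hfin : ∀ e : ℤ, {x : ℤ | g.eval x = e}.Finite := by
      intro e
      have hne : g - C e ≠ 0 := by
        intro h
        rw [sub_eq_zero] at h
        rw [h] at hg
        simp at hg
      refine (g - C e).roots.toFinset.finite_toSet.subset fun x hx => ?_
      have hx' : g.eval x = e := hx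
      rw [Finset.mem_coe, Multiset.mem_toFinset, mem_roots hne, IsRoot.def, eval_sub, eval_C, hx', sub_self]
    have hinf : (Set.range fun y : ℤ => c * D * y).Infinite :=
      Set.infinite_range_of_injective fun x y h => mul_left_cancel₀ (mul_ne_zero hc hD) h
    -- Avoiding the finitely many points where `g = ±c` keeps the cofactor different from `±1`.
    obtain ⟨m, ⟨y, rfl⟩, hm⟩ := (hinf.sdiff ((hfin c).union (hfin (-c)))).nonempty
    simp only [Set.mem_union, Set.mem_ofPred_eq, not_or] at hm
    obtain ⟨k, hk⟩ := g.sub_dvd_eval_sub (c * D * y) 0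
    have he : g.eval (c * D * y) = c * (1 + D * (y * k)) := by
      rw [← hcdef] at hk
      linear_combination hk
    have hu : (1 + D * (y * k)).natAbs ≠ 1 := by
      intro h
      rcases Int.natAbs_eq (1 + D * (y * k)) with h' | h' <;> rw [h, Nat.cast_one] at h'
      · exact hm.1 (by rw [he, h', mul_one])
      · exact hm.2 (by rw [he, h']; ring)
    obtain ⟨p, hp, hpd⟩ := Nat.exists_prime_and_dvd hu
    have hpd' : (p : ℤ) ∣ 1 + D * (y * k) := Int.natCast_dvd.2 hpd
    refine ⟨p, hp, fun h => ?_, c * D * y, he ▸ hpd'.mul_left c⟩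
    have h1 : (p : ℤ) ∣ 1 := (dvd_add_left (h.mul_right (y * k))).1 hpd'
    exact (Nat.prime_iff_prime_int.1 hp).not_isUnit (isUnit_of_dvd_one h1)

/-- `θ` is an integral multiple of a primitive element of `ℚ(α₁, …, αₙ)`; the integers `d` clear the
denominators of the roots written as polynomials in `θ`. -/
theorem exists_integral_generator {n : ℕ} (α : Fin n → ℂ) (hα : ∀ i, IsIntegral ℤ (α i)) :
    ∃ θ : ℂ, IsIntegral ℤ θ ∧ ∀ i, ∃ d : ℤ, d ≠ 0 ∧ ∃ h : ℤ[X], aeval θ h = d * α i := by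
  have hq : ∀ x ∈ Set.range α, IsIntegral ℚ x := by
    rintro _ ⟨i, rfl⟩
    exact (hα i).tower_top
  let K := IntermediateField.adjoin ℚ (Set.range α)
  have : FiniteDimensional ℚ K := IntermediateField.finiteDimensional_adjoin hq
  obtain ⟨θ₀, hθ₀⟩ := Field.exists_primitive_element ℚ K
  have halg : IsAlgebraic ℚ (θ₀ : ℂ) :=
    ((Algebra.IsIntegral.isIntegral (R := ℚ) θ₀).map K.val).isAlgebraic
  obtain ⟨y, hy, hyi⟩ := ((IsFractionRing.isAlgebraic_iff ℤ ℚ ℂ).2 halg).exists_integral_multiple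
  refine ⟨y • (θ₀ : ℂ), hyi, fun i => ?_⟩
  have hmem : (⟨α i, IntermediateField.subset_adjoin ℚ _ ⟨i, rfl⟩⟩ : K) ∈ IntermediateField.adjoin ℚ {θ₀} := by
    rw [hθ₀]; trivial
  rw [← IntermediateField.mem_toSubalgebra, IntermediateField.adjoin_simple_toSubalgebra_of_isAlgebraic
    (Algebra.IsAlgebraic.isAlgebraic (R := ℚ) θ₀), Algebra.adjoin_singleton_eq_range_aeval] at hmem
  obtain ⟨q, hq⟩ := hmem
  have hq' : aeval (θ₀ : ℂ) q = α i := by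
    have h1 : K.val (aeval θ₀ q) = α i := congrArg K.val hq
    rwa [← Polynomial.aeval_algHom_apply] at h1
  -- Composition with `y⁻¹X` turns a polynomial in `θ₀` into one in `θ = yθ₀`.
  obtain ⟨b, hb, hbq⟩ := IsLocalization.integerNormalization_spec (nonZeroDivisors ℤ)
    (q.comp (C ((y : ℚ)⁻¹) * X))
  refine ⟨b, nonZeroDivisors.ne_zero hb, IsLocalization.integerNormalization (nonZeroDivisors ℤ)
    (q.comp (C ((y : ℚ)⁻¹) * X)), ?_⟩
  have h2 := congrArg (aeval (y • (θ₀ : ℂ))) hbq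
  have hy' : (y : ℂ) ≠ 0 := Int.cast_ne_zero.2 hy
  rw [aeval_map_algebraMap] at h2
  rw [h2]
  simp [aeval_comp, hy', hq', Algebra.smul_def]

/-- A monic integral polynomial splits into linear factors modulo some prime. -/
theorem exists_prime_splits {n : ℕ} (f : ℤ[X]) (hf : f.Monic) (α : Fin n → ℂ)
    (hα : f.map (Int.castRingHom ℂ) = ∏ i, (X - C (α i))) :
    ∃ p : ℕ, p.Prime ∧ ∃ s : Fin n → ZMod p,
      f.map (Int.castRingHom (ZMod p)) = ∏ i, (X - C (s i)) := by
  have hint : ∀ i, IsIntegral ℤ (α i) := by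
    refine fun i => ⟨f, hf, ?_⟩
    have : (f.map (Int.castRingHom ℂ)).eval (α i) = 0 := by
      rw [hα, eval_prod]
      exact Finset.prod_eq_zero (Finset.mem_univ i) (by simp)
    rwa [eval_map] at this
  obtain ⟨θ, hθ, H⟩ := exists_integral_generator α hint
  choose d hd h hh using H
  obtain ⟨p, hp, hpd, m, hm⟩ := exists_prime_dvd_eval (minpoly.natDegree_pos hθ)
    (Finset.prod_ne_zero_iff.2 fun i (_ : i ∈ Finset.univ) => hd i)
  have := Fact.mk hp
  have hd0 : ∀ i, (d i : ZMod p) ≠ 0 := fun i h0 =>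
    hpd (((ZMod.intCast_zmod_eq_zero_iff_dvd _ _).1 h0).trans (Finset.dvd_prod_of_mem d (Finset.mem_univ i)))
  -- The reduction `θ ↦ m` from `ℤ[θ]` to `𝔽_p` is well defined: an integral polynomial vanishing at
  -- `θ` is a multiple of the minimal polynomial of `θ` over `ℤ`, which vanishes at `m` modulo `p`.
  have hvan : ∀ q : ℤ[X], aeval θ q = 0 → eval₂ (Int.castRingHom (ZMod p)) (m : ZMod p) q = 0 := by
    intro q hq
    obtain ⟨k, rfl⟩ := minpoly.isIntegrallyClosed_dvd hθ hq
    rw [eval₂_mul]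
    have : eval₂ (Int.castRingHom (ZMod p)) (m : ZMod p) (minpoly ℤ θ) = ((minpoly ℤ θ).eval m : ℤ) := by
      rw [← eq_intCast (Int.castRingHom (ZMod p)) m, eval₂_at_apply, eq_intCast]
    rw [this, (ZMod.intCast_zmod_eq_zero_iff_dvd _ _).2 hm, zero_mul]
  -- The coefficients are polynomials in a variable standing for `θ`. The factorization of `f` over
  -- `ℂ`, cleared of denominators, is `P = 0` at `θ`; it therefore also holds at `m` modulo `p`,
  -- where the `dᵢ` are invertible.
  let P : ℤ[X][X] := C (C (∏ i, d i)) * f.map C - ∏ i, (C (C (d i)) * X - C (h i))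
  have hP : P.map (aeval θ : ℤ[X] →ₐ[ℤ] ℂ).toRingHom = 0 := by
    have hcomp : (aeval θ : ℤ[X] →ₐ[ℤ] ℂ).toRingHom.comp C = Int.castRingHom ℂ := RingHom.ext_int _ _
    simp only [P, Polynomial.map_sub, Polynomial.map_mul, Polynomial.map_prod, Polynomial.map_map, hcomp, hα,
      map_C, map_X]
    simp only [AlgHom.toRingHom_eq_coe, RingHom.coe_coe, hh, eq_intCast, map_intCast, map_prod, C_mul, ← Finset.prod_mul_distrib, mul_sub, sub_self]
  have hP' : P.map (eval₂RingHom (Int.castRingHom (ZMod p)) (m : ZMod p)) = 0 := by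
    ext j
    rw [coeff_map, coeff_zero]
    apply hvan
    have := congrArg (fun q => coeff q j) hP
    simpa [coeff_map] using this
  have hcomp : (eval₂RingHom (Int.castRingHom (ZMod p)) (m : ZMod p)).comp C = Int.castRingHom (ZMod p) :=
    RingHom.ext_int _ _
  simp only [P, Polynomial.map_sub, Polynomial.map_mul, Polynomial.map_prod, Polynomial.map_map, hcomp,
      map_C, map_X, sub_eq_zero] at hP'
  refine ⟨p, hp, fun i => (d i : ZMod p)⁻¹ * eval₂ (Int.castRingHom (ZMod p)) (m : ZMod p) (h i), ?_⟩
  have hne : C ((∏ i, (d i : ZMod p))) ≠ 0 := by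
    rw [Ne, C_eq_zero, Finset.prod_eq_zero_iff]
    simpa using hd0
  apply mul_left_cancel₀ hne
  simp only [coe_eval₂RingHom, map_prod, eq_intCast, map_intCast] at hP'
  simp only [map_prod, map_intCast]
  rw [hP', ← Finset.prod_mul_distrib]
  refine Finset.prod_congr rfl fun i _ => ?_
  rw [mul_sub, ← map_intCast (C : ZMod p →+* (ZMod p)[X]), ← C_mul, ← mul_assoc, mul_inv_cancel₀ (hd0 i), one_mul]

theorem exists_isLocalRoots {n : ℕ} (f : ℤ[X]) (hf : f.Monic) (α : Fin n → ℂ)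
    (hα : f.map (Int.castRingHom ℂ) = ∏ i, (X - C (α i))) :
    ∃ p : ℕ, p.Prime ∧ ∃ r : Fin n → ℕ, IsLocalRoots f p r := by
  obtain ⟨p, hp, s, hs⟩ := exists_prime_splits f hf α hα
  have := Fact.mk hp
  refine ⟨p, hp, (fun i => (s i).val) ∘ Tuple.sort (fun i => (s i).val), ?_,
    Tuple.monotone_sort _, fun i => ZMod.val_lt _⟩
  rw [hs, ← Equiv.prod_comp (Tuple.sort (fun i => (s i).val))]
  simp

/-- A sorted list is determined by its multiset, here that of the roots of `f` modulo `p`. This lets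
conditions on the existentially quantified local roots be compared in `splSetOf_disjoint`. -/
theorem IsLocalRoots.unique {n : ℕ} {f : ℤ[X]} {p : ℕ} (hp : p.Prime) {r r' : Fin n → ℕ}
    (h : IsLocalRoots f p r) (h' : IsLocalRoots f p r') : r = r' := by
  have := Fact.mk hp
  have key : ∀ {r : Fin n → ℕ}, IsLocalRoots f p r →
      (f.map (Int.castRingHom (ZMod p))).roots.map ZMod.val = (List.ofFn r : Multiset ℕ) := by
    intro r h
    have hm : Finset.univ.val.map (fun i => X - C ((r i : ℕ) : ZMod p)) =
        (Finset.univ.val.map fun i => ((r i : ℕ) : ZMod p)).map fun a => X - C a := by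
      rw [Multiset.map_map]; rfl
    rw [h.1, Finset.prod_eq_multiset_prod, hm,
      roots_multiset_prod_X_sub_C, Multiset.map_map]
    have : ∀ i, (ZMod.val ∘ fun i => ((r i : ℕ) : ZMod p)) i = r i := fun i =>
      ZMod.val_cast_of_lt (h.2.2 i)
    rw [Multiset.map_congr rfl fun i _ => this i]
    simp [List.ofFn_eq_map]
  have hperm : (List.ofFn r).Perm (List.ofFn r') := Multiset.coe_eq_coe.1 ((key h).symm.trans (key h'))
  exact List.ofFn_injective (hperm.eq_of_sortedLE h.2.1.sortedLE_ofFn h'.2.1.sortedLE_ofFn)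

/-- The sum of the roots of a monic integral polynomial that splits over a ring `R` is the image of an
integer. -/
theorem sum_roots_eq {n : ℕ} {f : ℤ[X]} (hf : f.Monic) {R : Type*} [CommRing R]
    [Nontrivial R] {β : Fin n → R} (hβ : f.map (Int.castRingHom R) = ∏ i, (X - C (β i))) :
    ∑ i, β i = ((-f.nextCoeff : ℤ) : R) := by
  have h1 := nextCoeff_map_of_leadingCoeff_ne_zero (p := f) (Int.castRingHom R) (by simp [hf])
  rw [hβ, prod_X_sub_C_nextCoeff] at h1
  rw [Int.cast_neg, ← eq_intCast (Int.castRingHom R), ← h1, neg_neg]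

theorem mem_linRel_of_sum {n : ℕ} {α : Fin n → ℂ} {S : ℤ} (hS : ∑ i, α i = S) :
    ((fun _ => 1, (S : ℚ)) : (Fin n → ℚ) × ℚ) ∈ linRel α := by
  change ∑ i, ((1 : ℚ) : ℂ) * α i = ((S : ℚ) : ℂ)
  simp [hS]

theorem relDim_eq_one {n : ℕ} (hn : 0 < n) {α : Fin n → ℂ} {S : ℤ} (hS : ∑ i, α i = S)
    (hrel : ¬ HasNontrivialRel α) : relDim α = 1 := by
  refine le_antisymm (not_lt.1 hrel) ?_
  have : Nontrivial (linRel α) := by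
    refine ⟨⟨⟨_, mem_linRel_of_sum hS⟩, 0, fun h => ?_⟩⟩
    have := congrFun (congrArg (fun x => x.1.1) h) ⟨0, hn⟩
    simp at this
  exact Module.finrank_pos

theorem isIntRel_iff {n : ℕ} (hn : 0 < n) {α : Fin n → ℂ} {S : ℤ} (hS : ∑ i, α i = S)
    (hrel : ¬ HasNontrivialRel α) (m : Fin n → ℤ) (c : ℤ) :
    IsIntRel α m c ↔ ∃ d : ℤ, (∀ i, m i = d) ∧ c = d * S := by
  have hv : (⟨_, mem_linRel_of_sum hS⟩ : linRel α) ≠ 0 := fun h => by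
    have := congrFun (congrArg (fun x => x.1.1) h) ⟨0, hn⟩
    simp at this
  constructor
  · intro h
    -- The rational multiplier of `(1, …, 1, S)` is an integer because it equals each coordinate
    -- `mᵢ`.
    obtain ⟨q, hq⟩ := (finrank_eq_one_iff_of_nonzero' _ hv).1 (relDim_eq_one hn hS hrel)
      ⟨_, h⟩
    have h1 : ∀ i, q = m i := fun i => by
      simpa using congrFun (congrArg (fun x => x.1.1) hq) i
    have h2 : q * S = c := by simpa using congrArg (fun x => x.1.2) hq
    refine ⟨m ⟨0, hn⟩, fun i => ?_, ?_⟩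
    · exact_mod_cast (h1 i).symm.trans (h1 _)
    · rw [h1 ⟨0, hn⟩] at h2
      exact_mod_cast h2.symm
  · rintro ⟨d, hd, rfl⟩
    have := (linRel α).smul_mem (d : ℚ) (mem_linRel_of_sum hS)
    unfold IsIntRel
    convert this using 1
    ext <;> simp [hd]

theorem domain_one_eq {n : ℕ} (hn : 0 < n) {α : Fin n → ℂ} {S : ℤ} (hS : ∑ i, α i = S)
    (hrel : ¬ HasNontrivialRel α) :
    domain α 1 = {x | (∀ i, 0 ≤ x i ∧ x i ≤ 1) ∧ (∀ i j, i ≤ j → x i ≤ x j) ∧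
      ∃ k : ℤ, ∑ i, x i = (k : ℝ)} := by
  ext x
  refine and_congr_right fun _ => and_congr_right fun _ => ⟨fun h => ?_, ?_⟩
  · simpa using h (fun _ => 1) S ((isIntRel_iff hn hS hrel _ _).2 ⟨1, by simp⟩)
  · rintro ⟨k, hk⟩ m c h
    obtain ⟨d, hd, -⟩ := (isIntRel_iff hn hS hrel _ _).1 h
    exact ⟨d * k, by simp [hd, ← Finset.mul_sum, hk]⟩

theorem satisfiesRels_one {n : ℕ} (hn : 0 < n) {f : ℤ[X]} (hf : f.Monic) {α : Fin n → ℂ}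
    (hα : f.map (Int.castRingHom ℂ) = ∏ i, (X - C (α i))) (hrel : ¬ HasNontrivialRel α)
    {p : ℕ} (hp : p.Prime) {r : Fin n → ℕ} (hr : IsLocalRoots f p r) :
    SatisfiesRels α 1 p r := by
  have := Fact.mk hp
  intro m c h
  obtain ⟨d, hd, rfl⟩ := (isIntRel_iff hn (sum_roots_eq hf hα) hrel _ _).1 h
  rw [← ZMod.intCast_eq_intCast_iff]
  push_cast
  simp only [hd, ← Finset.mul_sum]
  simp [sum_roots_eq hf hr.1]

theorem splPerm_one_eq {n : ℕ} (hn : 0 < n) {f : ℤ[X]} (hf : f.Monic) {α : Fin n → ℂ}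
    (hα : f.map (Int.castRingHom ℂ) = ∏ i, (X - C (α i))) (hrel : ¬ HasNontrivialRel α) (X : ℝ) :
    SplPerm f α 1 X = Spl n f X := by
  ext p
  refine and_congr_right fun hp => and_congr_right fun _ => exists_congr fun r =>
    and_congr_right fun hr => ?_
  simp [satisfiesRels_one hn hf hα hrel hp hr]

theorem splPermIn_one_eq {n : ℕ} (hn : 0 < n) {f : ℤ[X]} (hf : f.Monic) {α : Fin n → ℂ}
    (hα : f.map (Int.castRingHom ℂ) = ∏ i, (X - C (α i))) (hrel : ¬ HasNontrivialRel α)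
    (D : Set (EuclideanSpace ℝ (Fin n))) (X : ℝ) :
    SplPermIn f α 1 D X = splSetOf n f X fun p r => rootPoint p r ∈ D := by
  ext p
  refine and_congr_right fun hp => and_congr_right fun _ => exists_congr fun r =>
    and_congr_right fun hr => ?_
  simp [satisfiesRels_one hn hf hα hrel hp hr]

theorem splSetOf_finite (n : ℕ) (f : ℤ[X]) (X : ℝ) (P : ℕ → (Fin n → ℕ) → Prop) :
    (splSetOf n f X P).Finite :=
  (Set.finite_Iic ⌊X⌋₊).subset fun _ hp => Nat.le_floor hp.2.1

theorem splSetOf_mono {n : ℕ} (f : ℤ[X]) (X : ℝ) {P Q : ℕ → (Fin n → ℕ) → Prop}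
    (h : ∀ p r, p.Prime → IsLocalRoots f p r → P p r → Q p r) :
    splSetOf n f X P ⊆ splSetOf n f X Q :=
  fun p hp => ⟨hp.1, hp.2.1, hp.2.2.imp fun r hr => ⟨hr.1, h p r hp.1 hr.1 hr.2⟩⟩

theorem splSetOf_disjoint {n : ℕ} (f : ℤ[X]) (X : ℝ) {P Q : ℕ → (Fin n → ℕ) → Prop}
    (h : ∀ p r, P p r → ¬ Q p r) :
    Disjoint (splSetOf n f X P) (splSetOf n f X Q) := by
  rw [Set.disjoint_left]
  rintro p ⟨hp, -, r, hr, hP⟩ ⟨-, -, r', hr', hQ⟩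
  obtain rfl := hr.unique hp hr'
  exact h p r hP hQ

theorem eventually_spl_ncard_pos {n : ℕ} {f : ℤ[X]} (hf : f.Monic) {α : Fin n → ℂ}
    (hα : f.map (Int.castRingHom ℂ) = ∏ i, (X - C (α i))) :
    ∀ᶠ X : ℝ in Filter.atTop, 0 < (Spl n f X).ncard := by
  obtain ⟨p, hp, r, hr⟩ := exists_isLocalRoots f hf α hα
  filter_upwards [Filter.eventually_ge_atTop (p : ℝ)] with X hX
  exact (Set.ncard_pos (splSetOf_finite n f X _)).2 ⟨p, hp, hX, r, hr, trivial⟩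

/-- The quotient is `1` as soon as `X` passes one splitting prime; before that it is `0 / 0 = 0`.
This is the only use of the existence of a splitting prime for positivity of the density. -/
theorem prPos_one {n : ℕ} (hn : 0 < n) {f : ℤ[X]} (hf : f.Monic) {α : Fin n → ℂ}
    (hα : f.map (Int.castRingHom ℂ) = ∏ i, (X - C (α i))) (hrel : ¬ HasNontrivialRel α) :
    PrPos f α 1 := by
  refine ⟨1, one_pos, tendsto_const_nhds.congr' ?_⟩
  filter_upwards [eventually_spl_ncard_pos hf hα] with X hX
  rw [splPerm_one_eq hn hf hα hrel, div_self (by exact_mod_cast hX.ne')]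

end LocalRoots

/-! ### Truncated powers and hyperplane sections of boxes. -/

namespace LocalRoots

open MeasureTheory Set
open AddMonoidAlgebra (single)

/-- The normalized truncated power `x₊ ^ N / N!`, right-continuous for `N = 0`. -/
noncomputable def truncPow (N : ℕ) (x : ℝ) : ℝ := if 0 ≤ x then x ^ N / (N.factorial : ℝ) else 0

theorem truncPow_monotone (N : ℕ) : Monotone (truncPow N) := by
  intro x y hxy
  unfold truncPow
  split_ifs with hx hy hy
  · gcongr
  · exact absurd (hx.trans hxy) hy
  · positivity
  · exact le_rfl

theorem truncPow_succ (N : ℕ) (x : ℝ) :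
    truncPow (N + 1) x = (max x 0) ^ (N + 1) / ((N + 1).factorial : ℝ) := by
  unfold truncPow
  split_ifs with hx
  · rw [max_eq_left hx]
  · rw [max_eq_right (not_le.1 hx).le]; simp

theorem hasDerivAt_truncPow_succ (N : ℕ) {x : ℝ} (hx : x ≠ 0) :
    HasDerivAt (truncPow (N + 1)) (truncPow N x) x := by
  rcases hx.lt_or_gt with hx | hx
  · have : truncPow N x = 0 := if_neg (not_le.2 hx)
    rw [this]
    refine (hasDerivAt_const x (0 : ℝ)).congr_of_eventuallyEq ?_
    filter_upwards [eventually_lt_nhds hx] with y hy using if_neg (not_le.2 hy)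
  · have : truncPow N x = ((N + 1 : ℕ) * x ^ N) / ((N + 1).factorial : ℝ) := by
      rw [truncPow, if_pos hx.le, Nat.factorial_succ, Nat.cast_mul, mul_div_mul_left]
      positivity
    rw [this]
    refine ((hasDerivAt_pow (N + 1) x).div_const _).congr_of_eventuallyEq ?_
    filter_upwards [eventually_gt_nhds hx] with y hy using if_pos hy.le

theorem integral_truncPow (N : ℕ) (u v : ℝ) :
    ∫ x in u..v, truncPow N x = truncPow (N + 1) v - truncPow (N + 1) u := by
  refine integral_eq_of_hasDerivAt_off_countable _ _ (countable_singleton (0 : ℝ)) ?_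
    (fun x hx => hasDerivAt_truncPow_succ N hx.2) (truncPow_monotone N).intervalIntegrable
  have : Continuous (truncPow (N + 1)) := by
    rw [funext (truncPow_succ N)]
    fun_prop
  exact this.continuousOn

/-- The functional `single s c ↦ c * (T - s)₊ ^ N / N!`. -/
noncomputable def truncEval (N : ℕ) (T : ℝ) : AddMonoidAlgebra ℝ ℝ →ₗ[ℝ] ℝ :=
  Finsupp.linearCombination ℝ (fun s => truncPow N (T - s)) ∘ₗ
    (AddMonoidAlgebra.coeffLinearEquiv ℝ).toLinearMap

@[simp]
theorem truncEval_single (N : ℕ) (T s c : ℝ) :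
    truncEval N T (single s c) = c * truncPow N (T - s) := by
  simp [truncEval]

theorem intervalIntegrable_truncEval (N : ℕ) (T : ℝ) (P : AddMonoidAlgebra ℝ ℝ) (b d : ℝ) :
    IntervalIntegrable (fun y => truncEval N (T - y) P) volume b d := by
  induction P using AddMonoidAlgebra.induction_linear with
  | zero => simp
  | add f g hf hg => simpa using hf.add hg
  | single s c =>
    simp only [truncEval_single]
    refine IntervalIntegrable.const_mul (Antitone.intervalIntegrable fun x y hxy => ?_) c
    exact truncPow_monotone N (by linarith)

/-- Integrating over one side of a box raises the degree by one and multiplies by `single b 1 -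
single d 1`, so iterated integrals become products. -/
theorem integral_truncEval (N : ℕ) (T : ℝ) (P : AddMonoidAlgebra ℝ ℝ) (b d : ℝ) :
    ∫ y in b..d, truncEval N (T - y) P =
      truncEval (N + 1) T ((single b 1 - single d 1) * P) := by
  induction P using AddMonoidAlgebra.induction_linear with
  | zero => simp
  | add f g hf hg =>
    simp only [map_add, mul_add]
    rw [intervalIntegral.integral_add (intervalIntegrable_truncEval ..)
      (intervalIntegrable_truncEval ..), hf, hg]
  | single s c =>
    have h := intervalIntegral.integral_comp_sub_left (fun x => truncPow N x) (T - s) (a := b) (b := d)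
    rw [integral_truncPow] at h
    simp only [truncEval_single, intervalIntegral.integral_const_mul, sub_mul,
      AddMonoidAlgebra.single_mul_single, one_mul, map_sub]
    rw [← mul_sub]
    convert! congrArg (c * ·) h using 2
    · exact intervalIntegral.integral_congr fun y _ => by simp only [sub_right_comm]
    · rw [sub_sub T s, sub_sub T s, add_comm s, add_comm s]

/-- The section of a half-open box by the hyperplane where the sum of the coordinates is `T`,
projected to all but the last coordinate. -/
def boxSection {N : ℕ} (b d : Fin (N + 1) → ℝ) (T : ℝ) : Set (Fin N → ℝ) :=
  {y | (∀ j, y j ∈ Ico (b j.castSucc) (d j.castSucc)) ∧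
    T - ∑ j, y j ∈ Ico (b (Fin.last N)) (d (Fin.last N))}

theorem measurableSet_boxSection {N : ℕ} (b d : Fin (N + 1) → ℝ) (T : ℝ) :
    MeasurableSet (boxSection b d T) := by
  unfold boxSection
  simp only [mem_Ico]
  measurability

/-- The volume of a hyperplane section of a box. -/
theorem volume_boxSection {N : ℕ} (b d : Fin (N + 1) → ℝ) (hbd : ∀ j, b j ≤ d j) (T : ℝ) :
    0 ≤ truncEval N T (∏ j, (single (b j) 1 - single (d j) 1)) ∧
    volume (boxSection b d T) =
      ENNReal.ofReal (truncEval N T (∏ j, (single (b j) 1 - single (d j) 1))) := by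
  induction N generalizing T with
  | zero =>
    -- The section is the single point of `ℝ⁰` or empty. Right-continuity of `truncPow 0` makes the
    -- difference exactly the indicator of `[b, d)`.
    have hv : truncEval 0 T (∏ j, (single (b j) 1 - single (d j) 1)) =
        if T ∈ Ico (b 0) (d 0) then 1 else 0 := by
      have := hbd 0
      rw [Fin.prod_univ_succ, Fin.prod_univ_zero, mul_one]
      simp only [map_sub, truncEval_single, truncPow, mem_Ico, sub_nonneg, pow_zero]
      split_ifs <;> simp at * <;> grind
    rw [hv]
    refine ⟨by split_ifs <;> norm_num, ?_⟩
    by_cases hT : T ∈ Ico (b 0) (d 0)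
    · have : boxSection b d T = univ := by ext y; simpa [boxSection] using hT
      rw [this, if_pos hT]
      simp [volume_pi]
    · have : boxSection b d T = ∅ := by ext y; simpa [boxSection] using hT
      rw [this, if_neg hT]; simp
  | succ N ih =>
    have ih' := ih (fun j => b j.succ) (fun j => d j.succ) (fun j => hbd _)
    rw [Fin.prod_univ_succ, ← integral_truncEval]
    set P := ∏ j : Fin (N + 1), (single (b j.succ) (1 : ℝ) - single (d j.succ) 1) with hP
    have hint := intervalIntegrable_truncEval N T P (b 0) (d 0)
    refine ⟨intervalIntegral.integral_nonneg (hbd 0) fun y _ => (ih' (T - y)).1, ?_⟩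
    -- Fubini in the first coordinate `y`: the slice is the section of the remaining box at level `T
    -- - y`. The nonnegativity half of the induction converts the integral to a lower integral.
    have hmp := (volume_preserving_piFinSuccAbove (fun _ : Fin (N + 1) => ℝ) 0).symm
    rw [← hmp.measure_preimage_equiv, Measure.volume_eq_prod, Measure.prod_apply
      ((MeasurableEquiv.measurable _) (measurableSet_boxSection b d T)),
      intervalIntegral.integral_of_le (hbd 0), ofReal_integral_eq_lintegral_ofReal
        ((intervalIntegrable_iff_integrableOn_Ioc_of_le (hbd 0)).1 hint)
        (Filter.Eventually.of_forall fun y => (ih' (T - y)).1),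
      ← setLIntegral_congr Ico_ae_eq_Ioc, ← lintegral_indicator measurableSet_Ico]
    refine lintegral_congr fun y => ?_
    by_cases hy : y ∈ Ico (b 0) (d 0)
    · rw [indicator_of_mem hy, ← (ih' (T - y)).2]
      congr 1
      ext z
      simp [boxSection, Fin.forall_fin_succ, Fin.sum_univ_succ, MeasurableEquiv.piFinSuccAbove,
        hy.1, hy.2, sub_sub]
    · rw [indicator_of_notMem hy]
      convert measure_empty (μ := (volume : Measure (Fin N → ℝ)))
      ext z
      rw [mem_Ico] at hy
      simp [boxSection, Fin.forall_fin_succ, Fin.sum_univ_succ, MeasurableEquiv.piFinSuccAbove]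
      tauto

end LocalRoots

/-! ### Volume on the hyperplanes of integral coordinate sum. -/

namespace LocalRoots

open MeasureTheory Set
open AddMonoidAlgebra (single)

/-- The parametrization of the hyperplane of vectors with coordinate sum `0` by the coordinates
other than the last one. -/
def sumZeroParam (N : ℕ) : (Fin N → ℝ) →ₗ[ℝ] EuclideanSpace ℝ (Fin (N + 1)) where
  toFun y := WithLp.toLp 2 (Fin.snoc y (-∑ j, y j) : Fin (N + 1) → ℝ)
  map_add' y z := by
    ext j
    refine Fin.lastCases ?_ (fun j => ?_) j
    · simp [Finset.sum_add_distrib]; ring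
    · simp
  map_smul' c y := by
    ext j
    refine Fin.lastCases ?_ (fun j => ?_) j
    · simp [Finset.mul_sum]
    · simp

@[simp]
theorem sumZeroParam_castSucc {N : ℕ} (y : Fin N → ℝ) (j : Fin N) :
    sumZeroParam N y j.castSucc = y j := by simp [sumZeroParam]

@[simp]
theorem sumZeroParam_last {N : ℕ} (y : Fin N → ℝ) :
    sumZeroParam N y (Fin.last N) = -∑ j, y j := by simp [sumZeroParam]

/-- The parametrization of the hyperplane of vectors with coordinate sum `s`. -/
noncomputable def sumParam (N : ℕ) (s : ℝ) (y : Fin N → ℝ) : EuclideanSpace ℝ (Fin (N + 1)) :=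
  sumZeroParam N y + EuclideanSpace.single (Fin.last N) s

@[simp]
theorem sumParam_castSucc {N : ℕ} (s : ℝ) (y : Fin N → ℝ) (j : Fin N) :
    sumParam N s y j.castSucc = y j := by simp [sumParam, Fin.castSucc_ne_last]

@[simp]
theorem sumParam_last {N : ℕ} (s : ℝ) (y : Fin N → ℝ) :
    sumParam N s y (Fin.last N) = s - ∑ j, y j := by simp [sumParam]; ring

theorem sum_sumParam {N : ℕ} (s : ℝ) (y : Fin N → ℝ) : ∑ j, sumParam N s y j = s := by
  simp [Fin.sum_univ_castSucc]

theorem sumParam_eq {N : ℕ} (x : EuclideanSpace ℝ (Fin (N + 1))) :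
    sumParam N (∑ j, x j) (fun j => x j.castSucc) = x := by
  ext j
  refine Fin.lastCases ?_ (fun j => ?_) j
  · simp [Fin.sum_univ_castSucc]
  · simp

/-- The factor by which `sumZeroParam N` scales volumes. -/
noncomputable def paramFactor (N : ℕ) : ℝ :=
  (sumZeroParam N ∘ₗ (WithLp.linearEquiv 2 ℝ (Fin N → ℝ)).toLinearMap :
    EuclideanSpace ℝ (Fin N) →ₗ[ℝ] EuclideanSpace ℝ (Fin (N + 1))).normDet

/-- Positivity suffices: the factor cancels in every ratio of volumes. -/
theorem paramFactor_pos (N : ℕ) : 0 < paramFactor N := by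
  refine (LinearMap.normDet_nonneg _).lt_of_ne' ?_
  rw [Ne, LinearMap.normDet_eq_zero_iff_ker_ne_bot, not_not, LinearMap.ker_eq_bot]
  intro y z h
  ext j
  simpa using congrArg (fun x : EuclideanSpace ℝ (Fin (N + 1)) => x j.castSucc) h

/-- The slice is a translate of a linear image, so its measure is the volume of the preimage times
the scaling factor of the linear map. -/
theorem hausdorff_inter_hyperplane {N : ℕ} (A : Set (EuclideanSpace ℝ (Fin (N + 1)))) (s : ℝ) :
    Measure.euclideanHausdorffMeasure N (A ∩ {x | ∑ j, x j = s}) =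
      ENNReal.ofReal (paramFactor N) * volume (sumParam N s ⁻¹' A) := by
  let L : EuclideanSpace ℝ (Fin N) →ₗ[ℝ] EuclideanSpace ℝ (Fin (N + 1)) :=
    sumZeroParam N ∘ₗ (WithLp.linearEquiv 2 ℝ (Fin N → ℝ)).toLinearMap
  have hset : A ∩ {x | ∑ j, x j = s} =
      IsometryEquiv.addRight (EuclideanSpace.single (Fin.last N) s) ''
        (L '' (WithLp.ofLp ⁻¹' (sumParam N s ⁻¹' A))) := by
    ext x
    simp only [image_image, mem_image, mem_preimage]
    constructor
    · rintro ⟨hx, rfl⟩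
      refine ⟨WithLp.toLp 2 fun j => x j.castSucc, ?_, ?_⟩
      · simpa only [sumParam_eq] using hx
      · exact sumParam_eq x
    · rintro ⟨y, hy, rfl⟩
      exact ⟨hy, sum_sumParam s _⟩
  have h := L.euclideanHausdorffMeasure_image_eq_normDet_mul_volume
    (WithLp.ofLp ⁻¹' (sumParam N s ⁻¹' A))
  rw [finrank_euclideanSpace_fin] at h
  rw [hset, (IsometryEquiv.isometry _).euclideanHausdorffMeasure_image, h]
  congr 1
  exact (PiLp.volume_preserving_ofLp (Fin N)).measure_preimage_equiv
    (f := (MeasurableEquiv.toLp 2 (Fin N → ℝ)).symm) _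

/-- The `N`-dimensional volume on the points of `ℝ^(N+1)` with integral coordinate sum. -/
noncomputable def sumMeasure (N : ℕ) : Measure (EuclideanSpace ℝ (Fin (N + 1))) :=
  (Measure.euclideanHausdorffMeasure N).restrict {x | ∃ k : ℤ, ∑ j, x j = k}

theorem measurableSet_integralSum (N : ℕ) :
    MeasurableSet {x : EuclideanSpace ℝ (Fin (N + 1)) | ∃ k : ℤ, ∑ j, x j = k} := by
  simp only [ofPred_exists]
  exact MeasurableSet.iUnion fun k => (isClosed_eq (by fun_prop) continuous_const).measurableSet

theorem sumMeasure_apply {N : ℕ} {A : Set (EuclideanSpace ℝ (Fin (N + 1)))}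
    (hA : MeasurableSet A) :
    sumMeasure N A =
      ENNReal.ofReal (paramFactor N) * ∑' k : ℤ, volume (sumParam N (k : ℝ) ⁻¹' A) := by
  have hset : A ∩ {x | ∃ k : ℤ, ∑ j, x j = k} = ⋃ k : ℤ, A ∩ {x | ∑ j, x j = (k : ℝ)} := by
    ext x; simp
  rw [sumMeasure, Measure.restrict_apply hA, hset, measure_iUnion, ← ENNReal.tsum_mul_left]
  · simp only [hausdorff_inter_hyperplane]
  · intro k l hkl
    refine Set.disjoint_left.2 fun x hx hy => hkl ?_
    exact_mod_cast hx.2.symm.trans hy.2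
  · exact fun k => hA.inter (isClosed_eq (by fun_prop) continuous_const).measurableSet

/-- As `u` varies along the direction `v` of the sheets, its level set meets each sheet in a
translate of a proper subspace or not at all. This disposes of the faces `xⱼ = c` and the ties `xᵢ =
xⱼ`. -/
theorem sumMeasure_hyperplane {N : ℕ} (u : EuclideanSpace ℝ (Fin (N + 1)) →ₗ[ℝ] ℝ)
    {v : EuclideanSpace ℝ (Fin (N + 1))} (hv : ∑ j, v j = 0) (huv : u v ≠ 0) (c : ℝ) :
    sumMeasure N {x | u x = c} = 0 := by
  have hu : Continuous u := u.continuous_of_finiteDimensional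
  rw [sumMeasure_apply (isClosed_eq hu continuous_const).measurableSet]
  refine mul_eq_zero_of_right _ (ENNReal.tsum_eq_zero.2 fun k => ?_)
  rcases (sumParam N (k : ℝ) ⁻¹' {x | u x = c}).eq_empty_or_nonempty with h | ⟨y₀, hy₀⟩
  · rw [h, measure_empty]
  · have hset : sumParam N (k : ℝ) ⁻¹' {x | u x = c} =
        (· + -y₀) ⁻¹' (LinearMap.ker (u ∘ₗ sumZeroParam N) : Set (Fin N → ℝ)) := by
      ext y
      have h0 : u (sumParam N (k : ℝ) y₀) = c := hy₀
      simp only [mem_preimage, mem_ofPred_eq, ← h0, SetLike.mem_coe, LinearMap.mem_ker,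
        LinearMap.comp_apply, sumParam, map_add, ← sub_eq_add_neg, add_left_inj]
      rw [map_sub, map_sub, sub_eq_zero]
    rw [hset, measure_preimage_add_right]
    refine Measure.addHaar_submodule _ _ fun h => huv ?_
    have h1 : (fun j => v j.castSucc) ∈ LinearMap.ker (u ∘ₗ sumZeroParam N) := h ▸ Submodule.mem_top
    have h2 := sumParam_eq v
    have h3 : EuclideanSpace.single (Fin.last N) (0 : ℝ) = 0 := by simp
    rw [hv, sumParam, h3, add_zero] at h2
    rw [← h2]
    exact h1

theorem sumMeasure_coord_eq {N : ℕ} (hN : 1 ≤ N) (j : Fin (N + 1)) (c : ℝ) :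
    sumMeasure N {x | x j = c} = 0 := by
  have : Nontrivial (Fin (N + 1)) := Fin.nontrivial_iff_two_le.2 (by omega)
  obtain ⟨i, hi⟩ := exists_ne j
  refine sumMeasure_hyperplane (EuclideanSpace.proj j : _ →L[ℝ] ℝ).toLinearMap
    (v := EuclideanSpace.single j 1 - EuclideanSpace.single i 1) ?_ ?_ c
  · simp [Finset.sum_sub_distrib, Finset.sum_ite_eq']
  · simp [hi.symm]

theorem sumMeasure_coord_eq_coord {N : ℕ} {i j : Fin (N + 1)} (hij : i ≠ j) :
    sumMeasure N {x | x i = x j} = 0 := by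
  have := sumMeasure_hyperplane ((EuclideanSpace.proj i : _ →L[ℝ] ℝ).toLinearMap -
    (EuclideanSpace.proj j : _ →L[ℝ] ℝ).toLinearMap)
    (v := EuclideanSpace.single i 1 - EuclideanSpace.single j 1) (N := N) ?_ ?_ 0
  · simpa [sub_eq_zero] using this
  · simp [Finset.sum_sub_distrib, Finset.sum_ite_eq']
  · simp [hij, hij.symm]

theorem measurePreserving_permute {N : ℕ} (σ : Equiv.Perm (Fin (N + 1))) :
    MeasurePreserving (fun x : EuclideanSpace ℝ (Fin (N + 1)) => WithLp.toLp 2 fun j => x (σ j))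
      (sumMeasure N) (sumMeasure N) := by
  have h := ((LinearIsometryEquiv.piLpCongrLeft 2 ℝ ℝ
    σ.symm).toIsometryEquiv.measurePreserving_euclideanHausdorffMeasure N).restrict_preimage
      (measurableSet_integralSum N)
  convert! h using 1
  rw [sumMeasure]
  congr 1
  ext x
  simp [Equiv.sum_comp σ (fun j => x j), LinearIsometryEquiv.piLpCongrLeft_apply]

/-- The half-open box `∏ [b j, d j)`. -/
def box {n : ℕ} (b d : Fin n → ℝ) : Set (EuclideanSpace ℝ (Fin n)) :=
  {x | ∀ j, b j ≤ x j ∧ x j < d j}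

theorem measurableSet_box {n : ℕ} (b d : Fin n → ℝ) : MeasurableSet (box b d) := by
  have : box b d = ⋂ j, ({x | b j ≤ x j} ∩ {x | x j < d j}) := by ext x; simp [box]
  rw [this]
  exact MeasurableSet.iInter fun j =>
    (isClosed_le continuous_const (by fun_prop)).measurableSet.inter
      (isOpen_lt (by fun_prop) continuous_const).measurableSet

theorem preimage_box {N : ℕ} (b d : Fin (N + 1) → ℝ) (s : ℝ) :
    sumParam N s ⁻¹' box b d = boxSection b d s := by
  ext y
  simp [box, boxSection, Fin.forall_fin_succ']

theorem sumMeasure_box {N : ℕ} (hN : 1 ≤ N) {b d : Fin (N + 1) → ℝ} (hb : ∀ j, 0 ≤ b j)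
    (hbd : ∀ j, b j ≤ d j) (hd : ∀ j, d j ≤ 1) :
    sumMeasure N (box b d) = ENNReal.ofReal (paramFactor N *
      ∑ m ∈ Finset.Icc 1 N, truncEval N m (∏ j, (single (b j) 1 - single (d j) 1))) := by
  rw [sumMeasure_apply (measurableSet_box b d), ENNReal.ofReal_mul (paramFactor_pos N).le]
  congr 1
  simp only [preimage_box]
  rw [ENNReal.ofReal_sum_of_nonneg fun (m : ℕ) _ => (volume_boxSection b d hbd m).1,
    tsum_eq_sum (s := (Finset.Icc 1 N).map Nat.castEmbedding), Finset.sum_map]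
  · exact Finset.sum_congr rfl fun m _ => (by simpa using (volume_boxSection b d hbd m).2)
  · intro k hk
    have hsum : ∀ y ∈ boxSection b d k, 0 ≤ ∑ j, y j ∧ ∑ j, y j ≤ k ∧ (k : ℝ) < N + 1 := by
      intro y hy
      have h1 : ∑ j, y j ≤ ∑ j : Fin N, (1 : ℝ) :=
        Finset.sum_le_sum fun j _ => (hy.1 j).2.le.trans (hd _)
      have h2 := hy.2.1
      have h3 := hy.2.2
      have h4 := hb (Fin.last N)
      have h5 := hd (Fin.last N)
      simp only [Finset.sum_const, Finset.card_univ, Fintype.card_fin, nsmul_eq_mul, mul_one] at h1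
      exact ⟨Finset.sum_nonneg fun j _ => (hb _).trans (hy.1 j).1, by linarith, by linarith⟩
    -- Coordinate sums lie in `[0, N + 1)`, so outside `1, …, N` only the sum `0` can occur, and
    -- only at the origin, a null set because `N ≥ 1`.
    have hsub : boxSection b d k ⊆ {0} := by
      intro y hy
      obtain ⟨h0, h1, h2⟩ := hsum y hy
      have hk1 : k < N + 1 := by exact_mod_cast h2
      have hk0 : 0 ≤ k := by exact_mod_cast h0.trans h1
      have hk' : k = 0 := by
        by_contra hne
        refine hk (Finset.mem_map.2 ⟨k.toNat, ?_, ?_⟩)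
        · rw [Finset.mem_Icc]; omega
        · simpa using hk0
      have hz : ∑ j, y j = 0 := le_antisymm (by simpa [hk'] using h1) h0
      rw [Finset.sum_eq_zero_iff_of_nonneg fun j _ => (hb _).trans (hy.1 j).1] at hz
      exact funext fun j => hz j (Finset.mem_univ j)
    have : Nonempty (Fin N) := ⟨⟨0, hN⟩⟩
    exact measure_mono_null hsub (measure_singleton _)

/-- Given the first `N` coordinates in `[0, 1)`, exactly one last coordinate in `[0, 1)` makes the
sum integral. The sections thus project onto a partition of the unit cube, of volume `1`. -/
theorem sumMeasure_unitBox (N : ℕ) :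
    sumMeasure N (box 0 1) = ENNReal.ofReal (paramFactor N) := by
  rw [sumMeasure_apply (measurableSet_box _ _)]
  simp only [preimage_box]
  rw [← measure_iUnion]
  · have : (⋃ k : ℤ, boxSection (0 : Fin (N + 1) → ℝ) 1 k) = univ.pi fun _ => Ico 0 1 := by
      ext y
      simp only [mem_iUnion, boxSection, mem_ofPred_eq, Pi.zero_apply, Pi.one_apply, mem_pi,
        mem_univ, true_imp_iff, exists_and_left, and_iff_left_iff_imp]
      refine fun _ => ⟨⌈∑ j, y j⌉, ?_, ?_⟩
      · linarith [Int.le_ceil (∑ j, y j)]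
      · linarith [Int.ceil_lt_add_one (∑ j, y j)]
    rw [this, Real.volume_pi_Ico]
    simp
  · intro k l hkl
    refine Set.disjoint_left.2 fun y hy hy' => hkl ?_
    have h1 := hy.2
    have h2 := hy'.2
    simp only [Pi.zero_apply, Pi.one_apply, mem_Ico] at h1 h2
    have h3 : (k : ℝ) < l + 1 := by linarith
    have h4 : (l : ℝ) < k + 1 := by linarith
    have h3' : k < l + 1 := by exact_mod_cast h3
    have h4' : l < k + 1 := by exact_mod_cast h4
    omega
  · exact fun k => measurableSet_boxSection _ _ _

end LocalRoots

/-! ### Removing the ordering of the coordinates. -/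

namespace LocalRoots

open MeasureTheory Set
open AddMonoidAlgebra (single)

/-- The points with weakly increasing coordinates. -/
def sortedPoints (n : ℕ) : Set (EuclideanSpace ℝ (Fin n)) := {x | ∀ i j, i ≤ j → x i ≤ x j}

theorem measurableSet_sortedPoints (n : ℕ) : MeasurableSet (sortedPoints n) := by
  unfold sortedPoints
  simp only [ofPred_forall]
  exact MeasurableSet.iInter fun i => MeasurableSet.iInter fun j => MeasurableSet.iInter fun _ =>
    (isClosed_le (by fun_prop) (by fun_prop)).measurableSet

/-- A permutation invariant set decomposes, up to ties, into `(N + 1)!` copies of its sorted part. -/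
theorem sumMeasure_eq_factorial_mul {N : ℕ} {A : Set (EuclideanSpace ℝ (Fin (N + 1)))}
    (hA : MeasurableSet A)
    (hinv : ∀ (σ : Equiv.Perm (Fin (N + 1))) (x : EuclideanSpace ℝ (Fin (N + 1))),
      (WithLp.toLp 2 fun j => x (σ j)) ∈ A ↔ x ∈ A) :
    sumMeasure N A = ((N + 1).factorial : ENNReal) * sumMeasure N (A ∩ sortedPoints (N + 1)) := by
  let I : Set (EuclideanSpace ℝ (Fin (N + 1))) := {x | Function.Injective x.ofLp}
  have hIc : Iᶜ = ⋃ i : Fin (N + 1), ⋃ j : Fin (N + 1), ⋃ _ : i ≠ j, {x | x i = x j} := by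
    ext x
    simp only [I, mem_compl_iff, mem_ofPred_eq, mem_iUnion, Function.Injective, not_forall,
      exists_prop]
    exact exists_congr fun i => exists_congr fun j => and_comm
  have hIm : MeasurableSet I := by
    rw [← MeasurableSet.compl_iff, hIc]
    exact MeasurableSet.iUnion fun i => MeasurableSet.iUnion fun j => MeasurableSet.iUnion fun _ =>
      (isClosed_eq (by fun_prop) (by fun_prop)).measurableSet
  have hI0 : sumMeasure N Iᶜ = 0 := by
    rw [hIc]
    exact measure_iUnion_null fun i => measure_iUnion_null fun j => measure_iUnion_null fun h =>
      sumMeasure_coord_eq_coord h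
  have hres : ∀ B, sumMeasure N B = sumMeasure N (B ∩ I) := fun B =>
    (measure_inter_conull hI0).symm
  let φ : Equiv.Perm (Fin (N + 1)) → EuclideanSpace ℝ (Fin (N + 1)) →
    EuclideanSpace ℝ (Fin (N + 1)) := fun σ x => WithLp.toLp 2 fun j => x (σ j)
  -- Off the ties, each point is sorted by exactly one permutation, so the union is disjoint.
  have hdec : A ∩ I = ⋃ σ, φ σ ⁻¹' (A ∩ sortedPoints (N + 1) ∩ I) := by
    ext x
    simp only [mem_iUnion, mem_preimage]
    have hI : ∀ σ, φ σ x ∈ I ↔ x ∈ I := fun σ => by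
      change Function.Injective (x.ofLp ∘ σ) ↔ Function.Injective x.ofLp
      exact σ.injective_comp _
    constructor
    · rintro ⟨hxA, hxI⟩
      refine ⟨Tuple.sort x.ofLp, ⟨(hinv _ x).2 hxA, ?_⟩, (hI _).2 hxI⟩
      exact fun i j hij => Tuple.monotone_sort x.ofLp hij
    · rintro ⟨σ, ⟨hxA, -⟩, hxI⟩
      exact ⟨(hinv _ x).1 hxA, (hI _).1 hxI⟩
  have hmeas : MeasurableSet (A ∩ sortedPoints (N + 1) ∩ I) :=
    (hA.inter (measurableSet_sortedPoints _)).inter hIm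
  rw [hres A, hres (A ∩ sortedPoints (N + 1)), hdec, measure_iUnion, tsum_fintype]
  · simp only [φ, fun σ => (measurePreserving_permute (N := N) σ).measure_preimage
      hmeas.nullMeasurableSet]
    simp [Fintype.card_perm]
  · intro σ τ hστ
    refine Set.disjoint_left.2 fun x hx hy => hστ ?_
    have h1 : StrictMono (x.ofLp ∘ σ) :=
      Monotone.strictMono_of_injective (fun i j h => hx.1.2 i j h) hx.2
    have h2 : StrictMono (x.ofLp ∘ τ) :=
      Monotone.strictMono_of_injective (fun i j h => hy.1.2 i j h) hy.2
    have hinj : Function.Injective x.ofLp := (σ.injective_comp _).1 hx.2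
    have h3 : x.ofLp ∘ σ = x.ofLp ∘ τ := (h1.range_inj h2).1 (by
      rw [range_comp, range_comp, σ.surjective.range_eq, τ.surjective.range_eq])
    exact Equiv.ext fun j => hinj (congrFun h3 j)
  · exact fun σ => (measurePreserving_permute σ).measurable hmeas

/-- The points of the unit box with at least `k` coordinates below `a`. -/
def lowCoords (n k : ℕ) (a : ℝ) : Set (EuclideanSpace ℝ (Fin n)) :=
  {x | x ∈ box 0 1 ∧ k ≤ (Finset.univ.filter fun j => x j < a).card}

theorem lowCoords_eq_biUnion {n k : ℕ} {a : ℝ} (ha0 : 0 ≤ a) (ha1 : a ≤ 1) :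
    lowCoords n k a = ⋃ S ∈ Finset.univ.filter (fun S : Finset (Fin n) => k ≤ S.card),
      box (fun j => if j ∈ S then 0 else a) (fun j => if j ∈ S then a else 1) := by
  ext x
  simp only [lowCoords, mem_ofPred_eq, mem_iUnion, Finset.mem_filter, Finset.mem_univ, true_and,
    exists_prop, box, Pi.zero_apply, Pi.one_apply]
  constructor
  · rintro ⟨hx, hk⟩
    refine ⟨_, hk, fun j => ?_⟩
    have := hx j
    by_cases hj : x j < a
    · simp [hj, this]
    · simp [hj, this, not_lt.1 hj]
  · rintro ⟨S, hk, hx⟩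
    have hS : (Finset.univ.filter fun j => x j < a) = S := by
      ext j
      have := hx j
      by_cases hj : j ∈ S
      · simp_all
      · simp_all
    refine ⟨fun j => ?_, hS ▸ hk⟩
    have := hx j
    by_cases hj : j ∈ S
    · simp only [hj, if_true] at this; exact ⟨this.1, this.2.trans_le ha1⟩
    · simp only [hj, if_false] at this; exact ⟨ha0.trans this.1, this.2⟩

theorem measurableSet_lowCoords {n k : ℕ} {a : ℝ} (ha0 : 0 ≤ a) (ha1 : a ≤ 1) :
    MeasurableSet (lowCoords n k a) := by
  rw [lowCoords_eq_biUnion ha0 ha1]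
  exact Finset.measurableSet_biUnion _ fun _ _ => measurableSet_box _ _

/-- The normalized volume of the points with integral coordinate sum in the product of `k` copies
of `[0, a)` and `q` copies of `[a, 1)`. -/
noncomputable def sectionVolume (N k q : ℕ) (a : ℝ) : ℝ :=
  ∑ m ∈ Finset.Icc 1 N, truncEval N m
    ((single 0 1 - single a 1) ^ k * (single a 1 - single 1 1) ^ q)

/-- Points are classified by the set `S` of coordinates below `a`; the volume of the corresponding
box depends only on the size of `S`, whence the binomial coefficient. -/
theorem sumMeasure_real_lowCoords {N k : ℕ} (hN : 1 ≤ N) {a : ℝ} (ha0 : 0 ≤ a) (ha1 : a ≤ 1) :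
    (sumMeasure N).real (lowCoords (N + 1) k a) = paramFactor N *
      ∑ l ∈ Finset.Icc k (N + 1), ((N + 1).choose l : ℝ) * sectionVolume N l (N + 1 - l) a := by
  have hbox : ∀ S : Finset (Fin (N + 1)), (sumMeasure N).real
      (box (fun j => if j ∈ S then 0 else a) (fun j => if j ∈ S then a else 1)) =
        paramFactor N * sectionVolume N S.card (N + 1 - S.card) a ∧ sumMeasure N
      (box (fun j => if j ∈ S then 0 else a) (fun j => if j ∈ S then a else 1)) ≠ ⊤ := by
    intro S
    have hb : ∀ j, 0 ≤ (if j ∈ S then 0 else a) := fun j => by split_ifs <;> simp [ha0]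
    have hd : ∀ j, (if j ∈ S then a else 1) ≤ 1 := fun j => by split_ifs <;> simp [ha1]
    have hbd : ∀ j, (if j ∈ S then 0 else a) ≤ (if j ∈ S then a else 1) := fun j => by
      split_ifs <;> simp [ha0, ha1]
    have hprod : ∏ j : Fin (N + 1), (single (if j ∈ S then 0 else a) (1 : ℝ) -
        single (if j ∈ S then a else 1) 1) =
        (single 0 1 - single a 1) ^ S.card * (single a 1 - single 1 1) ^ (N + 1 - S.card) := by
      rw [← Finset.prod_mul_prod_compl S, Finset.prod_congr rfl fun j (hj : j ∈ S) => by
        rw [if_pos hj, if_pos hj], Finset.prod_const, Finset.prod_congr rfl fun j (hj : j ∈ Sᶜ) => by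
        rw [if_neg (Finset.mem_compl.1 hj), if_neg (Finset.mem_compl.1 hj)], Finset.prod_const,
        Finset.card_compl, Fintype.card_fin]
    rw [Measure.real, sumMeasure_box hN hb hbd hd]
    refine ⟨?_, ENNReal.ofReal_ne_top⟩
    rw [ENNReal.toReal_ofReal, hprod, sectionVolume]
    exact mul_nonneg (paramFactor_pos N).le
      (Finset.sum_nonneg fun m _ => (volume_boxSection _ _ hbd m).1)
  rw [lowCoords_eq_biUnion ha0 ha1, measureReal_biUnion_finset ?_ (fun _ _ => measurableSet_box _ _) (fun S _ => (hbox S).2),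
    Finset.sum_congr rfl fun S _ => (hbox S).1, ← Finset.mul_sum]
  · congr 1
    have h := Finset.sum_powerset_apply_card (fun l => if k ≤ l then sectionVolume N l (N + 1 - l) a
      else 0) (x := (Finset.univ : Finset (Fin (N + 1))))
    rw [Finset.powerset_univ, ← Finset.sum_filter, Finset.card_univ, Fintype.card_fin] at h
    rw [h]
    simp only [nsmul_eq_mul, mul_ite, mul_zero]
    rw [← Finset.sum_filter]
    refine Finset.sum_congr ?_ fun _ _ => rfl
    ext l
    simp only [Finset.mem_filter, Finset.mem_range, Finset.mem_Icc]
    omega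
  · intro S _ T _ hST
    refine Set.disjoint_left.2 fun x hx hy => hST ?_
    have key : ∀ {S : Finset (Fin (N + 1))}, x ∈ box (fun j => if j ∈ S then 0 else a)
        (fun j => if j ∈ S then a else 1) → ∀ j, j ∈ S ↔ x j < a := by
      intro S hx j
      have := hx j
      by_cases hj : j ∈ S <;> simp_all
    ext j
    rw [key hx, key hy]

/-- For sorted points, at least `i + 1` coordinates are below `a` if and only if the `i`-th
coordinate is. -/
theorem lowCoords_inter_sortedPoints {n : ℕ} (i : Fin n) (a : ℝ) :
    lowCoords n (i + 1) a ∩ sortedPoints n = {x | x i < a} ∩ box 0 1 ∩ sortedPoints n := by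
  ext x
  simp only [lowCoords, mem_inter_iff, mem_ofPred_eq]
  refine and_congr_left fun hs => ?_
  rw [and_comm]
  refine and_congr_left fun _ => ⟨fun h => ?_, fun h => ?_⟩
  · by_contra hi
    have hsub : (Finset.univ.filter fun j => x j < a) ⊆ Finset.Iio i := by
      intro j hj
      rw [Finset.mem_Iio]
      by_contra hji
      exact hi ((hs i j (not_lt.1 hji)).trans_lt (Finset.mem_filter.1 hj).2)
    have := Finset.card_le_card hsub
    rw [Fin.card_Iio] at this
    omega
  · have hsub : Finset.Iic i ⊆ (Finset.univ.filter fun j => x j < a) := fun j hj =>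
      Finset.mem_filter.2 ⟨Finset.mem_univ j, (hs j i (Finset.mem_Iic.1 hj)).trans_lt h⟩
    simpa using Finset.card_le_card hsub

theorem permute_mem_lowCoords {n k : ℕ} {a : ℝ} (σ : Equiv.Perm (Fin n))
    (x : EuclideanSpace ℝ (Fin n)) :
    (WithLp.toLp 2 fun j => x (σ j)) ∈ lowCoords n k a ↔ x ∈ lowCoords n k a := by
  refine and_congr (σ.forall_congr_left (p := fun j => 0 ≤ x (σ j) ∧ x (σ j) < 1) |>.trans
    (by simp [box])) ?_
  have : (Finset.univ.filter fun j => x j < a) =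
      (Finset.univ.filter fun j => x (σ j) < a).map σ.toEmbedding := by
    ext j; simp
  rw [this, Finset.card_map]

theorem lowCoords_zero (n : ℕ) (a : ℝ) : lowCoords n 0 a = box 0 1 := by
  ext x; simp [lowCoords]

end LocalRoots

/-! ### Expansion of the section volumes into the explicit sum. -/

namespace LocalRoots

open AddMonoidAlgebra (single)

/-- Binomial expansion of both powers: `u` counts the factors contributing the endpoint `0`, `v`
those contributing `1`, and the remaining ones contribute `a`. -/
theorem truncEval_pow_mul_pow (N k q : ℕ) (T a : ℝ) :
    truncEval N T ((single 0 1 - single a 1) ^ k * (single a 1 - single 1 1) ^ q) =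
      ∑ u ∈ Finset.range (k + 1), ∑ v ∈ Finset.range (q + 1),
        (-1 : ℝ) ^ (k - u) * (-1) ^ v * (k.choose u : ℝ) * (q.choose v : ℝ) *
          truncPow N (T - v - ((k - u : ℕ) + (q - v : ℕ)) * a) := by
  have hneg : ∀ s : ℝ, -single s (1 : ℝ) = single s (-1 : ℝ) := fun s => by
    rw [neg_eq_iff_add_eq_zero, ← AddMonoidAlgebra.single_add, add_neg_cancel,
      AddMonoidAlgebra.single_zero]
  rw [sub_eq_add_neg, sub_eq_neg_add (single a 1), add_pow, add_pow, Finset.sum_mul_sum, map_sum,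
    hneg, hneg]
  refine Finset.sum_congr rfl fun u _ => ?_
  rw [map_sum]
  refine Finset.sum_congr rfl fun v _ => ?_
  simp only [AddMonoidAlgebra.single_pow, AddMonoidAlgebra.natCast_def,
    AddMonoidAlgebra.single_mul_single, truncEval_single]
  congr 1
  · simp only [one_pow]; ring
  · congr 1
    simp only [nsmul_eq_mul]
    ring

theorem factorial_mul_truncPow {N : ℕ} (hN : 1 ≤ N) (x : ℝ) :
    (N.factorial : ℝ) * truncPow N x = max x 0 ^ N := by
  obtain ⟨N, rfl⟩ := Nat.exists_eq_add_of_le' hN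
  rw [truncPow_succ, mul_div_cancel₀]
  positivity

theorem binom_natCast (A B : ℕ) : binom A (B : ℤ) = A.choose B := by
  simp [binom]

theorem eq_natCast_of_binom_ne_zero {A : ℕ} {B : ℤ} (h : binom A B ≠ 0) :
    ∃ b : ℕ, b ≤ A ∧ B = b := by
  unfold binom at h
  split_ifs at h with hB
  · refine ⟨B.toNat, ?_, (Int.toNat_of_nonneg hB).symm⟩
    by_contra hlt
    exact h (by rw [Nat.choose_eq_zero_of_lt (not_le.1 hlt), Nat.cast_zero])
  · exact absurd rfl h

theorem factorial_mul_truncEval {N k m : ℕ} (hN : 1 ≤ N) (hk : k ≤ N + 1) (hm : m ∈ Finset.Icc 1 N)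
    {a : ℝ} (ha : 0 ≤ a) :
    (N.factorial : ℝ) * truncEval N m
        ((single 0 1 - single a 1) ^ k * (single a 1 - single 1 1) ^ (N + 1 - k)) =
      ∑ h ∈ Finset.range (N + 1 + 1), ∑ l ∈ Finset.Icc 1 N, (-1 : ℝ) ^ (h + k + (N + 1)) *
        (binom k (((N + 1 : ℕ) : ℤ) - h - m + l) * binom (N + 1 - k) ((m : ℤ) - l)) *
          (max ((l : ℝ) - h * a) 0) ^ N := by
  obtain ⟨q, hq⟩ := Nat.exists_eq_add_of_le hk
  have hq' : N + 1 - k = q := by omega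
  rw [hq', truncEval_pow_mul_pow, Finset.mul_sum]
  simp only [Finset.mul_sum]
  rw [← Finset.sum_product', ← Finset.sum_product']
  rw [Finset.mem_Icc] at hm
  -- For `l ≤ 0` the truncated power vanishes, which is why the sum over `l` may start at `1`.
  have hpos : ∀ (l : ℤ) (h : ℕ), max ((l : ℝ) - h * a) 0 ^ N ≠ 0 → 1 ≤ l := by
    intro l h hne
    by_contra hl
    refine hne ?_
    have hl' : (l : ℝ) ≤ 0 := by exact_mod_cast (by omega : l ≤ 0)
    have : 0 ≤ (h : ℝ) * a := by positivity
    rw [max_eq_right (by linarith), zero_pow (by omega)]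
  have hterm : ∀ u v : ℕ, (N.factorial : ℝ) * ((-1 : ℝ) ^ (k - u) * (-1) ^ v * (k.choose u : ℝ) *
      (q.choose v : ℝ) * truncPow N ((m : ℝ) - v - ((k - u : ℕ) + (q - v : ℕ)) * a)) =
      (-1 : ℝ) ^ (k - u) * (-1) ^ v * (k.choose u : ℝ) * (q.choose v : ℝ) *
        max ((((m : ℤ) - v : ℤ) : ℝ) - ((k - u + (q - v) : ℕ) : ℝ) * a) 0 ^ N := by
    intro u v
    rw [← factorial_mul_truncPow hN]
    push_cast
    ring
  have hv : ∀ u v : ℕ, (N.factorial : ℝ) * ((-1 : ℝ) ^ (k - u) * (-1) ^ v * (k.choose u : ℝ) *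
      (q.choose v : ℝ) * truncPow N ((m : ℝ) - v - ((k - u : ℕ) + (q - v : ℕ)) * a)) ≠ 0 →
      v + 1 ≤ m := by
    intro u v hne
    rw [hterm] at hne
    have := hpos _ _ (right_ne_zero_of_mul hne)
    omega
  -- Reindexing: `h` is the number of endpoints equal to `a` and `l = m - v`; conversely `v = m - l`
  -- and `u = n - h - m + l` with `n = N + 1`. Terms without a partner vanish, through the truncated
  -- power or through the convention for `binom`.
  refine Finset.sum_bij_ne_zero (fun x _ _ => (k - x.1 + (q - x.2), m - x.2)) ?_ ?_ ?_ ?_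
  · rintro ⟨u, v⟩ hx hne
    have := hv u v hne
    simp only [Finset.mem_product, Finset.mem_range, Finset.mem_Icc] at hx ⊢
    omega
  · rintro ⟨u, v⟩ hx hne ⟨u', v'⟩ hx' hne' heq
    have := hv u v hne
    have := hv u' v' hne'
    simp only [Finset.mem_product, Finset.mem_range, Prod.mk.injEq] at hx hx' heq ⊢
    omega
  · rintro ⟨h, l⟩ hx hne
    simp only at hne
    obtain ⟨u, hu, hu'⟩ := eq_natCast_of_binom_ne_zero
      (left_ne_zero_of_mul (right_ne_zero_of_mul (left_ne_zero_of_mul hne)))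
    obtain ⟨v, hvq, hv'⟩ := eq_natCast_of_binom_ne_zero
      (right_ne_zero_of_mul (right_ne_zero_of_mul (left_ne_zero_of_mul hne)))
    simp only [Finset.mem_product, Finset.mem_range, Finset.mem_Icc] at hx
    have h1 : h = k - u + (q - v) := by omega
    have h2 : (l : ℤ) = (m : ℤ) - v := by omega
    have h3 : (l : ℝ) = (((m : ℤ) - v : ℤ) : ℝ) := by rw [← h2]; simp
    refine ⟨(u, v), ?_, ?_, ?_⟩
    · simp only [Finset.mem_product, Finset.mem_range]; omega
    · rw [hterm]
      refine mul_ne_zero (mul_ne_zero (mul_ne_zero (mul_ne_zero ?_ ?_) ?_) ?_) ?_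
      · exact pow_ne_zero _ (by norm_num)
      · exact pow_ne_zero _ (by norm_num)
      · exact_mod_cast (Nat.choose_pos hu).ne'
      · exact_mod_cast (Nat.choose_pos hvq).ne'
      · rw [← h1, ← h3]; exact right_ne_zero_of_mul hne
    · rw [Prod.mk.injEq]; omega
  · rintro ⟨u, v⟩ hx hne
    have hvm := hv u v hne
    simp only [Finset.mem_product, Finset.mem_range] at hx
    rw [hterm]
    have e1 : (((N + 1 : ℕ) : ℤ) - ((k - u + (q - v) : ℕ) : ℤ) - m + ((m - v : ℕ) : ℤ)) = u := by
      omega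
    have e2 : (m : ℤ) - ((m - v : ℕ) : ℤ) = v := by omega
    have e3 : (((m : ℤ) - v : ℤ) : ℝ) = ((m - v : ℕ) : ℝ) := by
      rw [Nat.cast_sub (by omega)]; push_cast; ring
    have e4 : (-1 : ℝ) ^ (k - u + (q - v) + k + (N + 1)) = (-1) ^ (k - u) * (-1) ^ v := by
      rw [← pow_add]
      refine neg_one_pow_congr ?_
      rw [Nat.even_iff, Nat.even_iff]
      omega
    simp only
    rw [e1, e2, e3, e4, binom_natCast, binom_natCast]
    ring

theorem rootSum_eq {N k : ℕ} (hN : 1 ≤ N) {a : ℝ} (ha : 0 ≤ a) :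
    rootSum (N + 1) k a = (N.factorial : ℝ) *
      ∑ l ∈ Finset.Icc k (N + 1), ((N + 1).choose l : ℝ) * sectionVolume N l (N + 1 - l) a := by
  have h : ∀ l ∈ Finset.Icc k (N + 1), (N.factorial : ℝ) * (((N + 1).choose l : ℝ) *
      sectionVolume N l (N + 1 - l) a) = ((N + 1).choose l : ℝ) * ∑ m ∈ Finset.Icc 1 N,
      ∑ h ∈ Finset.range (N + 1 + 1), ∑ j ∈ Finset.Icc 1 N, (-1 : ℝ) ^ (h + l + (N + 1)) *
        (binom l (((N + 1 : ℕ) : ℤ) - h - m + j) * binom (N + 1 - l) ((m : ℤ) - j)) *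
          (max ((j : ℝ) - h * a) 0) ^ N := by
    intro l hl
    rw [mul_left_comm, sectionVolume, Finset.mul_sum]
    congr 1
    exact Finset.sum_congr rfl fun m hm =>
      factorial_mul_truncEval hN (Finset.mem_Icc.1 hl).2 hm ha
  rw [Finset.mul_sum, Finset.sum_congr rfl h, rootSum, Nat.add_sub_cancel]
  simp only [Finset.mul_sum, Finset.sum_mul]
  rw [Finset.sum_congr rfl fun h _ => Finset.sum_comm, Finset.sum_comm]
  refine Finset.sum_congr rfl fun l _ => ?_
  rw [Finset.sum_congr rfl fun h _ => Finset.sum_comm, Finset.sum_comm]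
  refine Finset.sum_congr rfl fun m _ => Finset.sum_congr rfl fun h _ =>
    Finset.sum_congr rfl fun j _ => ?_
  ring

end LocalRoots

/-! ### From the conjecture to the density of `rᵢ/p < a`. -/

namespace LocalRoots

open MeasureTheory Set Filter Topology Polynomial

/-- The closed box `∏ [lo j, hi j]`. -/
def closedBox {n : ℕ} (lo hi : Fin n → ℝ) : Set (EuclideanSpace ℝ (Fin n)) :=
  {x | ∀ j, lo j ≤ x j ∧ x j ≤ hi j}

/-- The open box `∏ (lo j, hi j)`. -/
def openBox {n : ℕ} (lo hi : Fin n → ℝ) : Set (EuclideanSpace ℝ (Fin n)) :=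
  {x | ∀ j, lo j < x j ∧ x j < hi j}

theorem isClosed_closedBox {n : ℕ} (lo hi : Fin n → ℝ) : IsClosed (closedBox lo hi) := by
  have : closedBox lo hi = ⋂ j, ({x | lo j ≤ x j} ∩ {x | x j ≤ hi j}) := by
    ext x; simp [closedBox]
  rw [this]
  exact isClosed_iInter fun j => (isClosed_le continuous_const (by fun_prop)).inter
    (isClosed_le (by fun_prop) continuous_const)

theorem openBox_subset_interior {n : ℕ} (lo hi : Fin n → ℝ) :
    openBox lo hi ⊆ interior (closedBox lo hi) := by
  refine interior_maximal (fun x hx j => ⟨(hx j).1.le, (hx j).2.le⟩) ?_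
  have : openBox lo hi = ⋂ j, ({x | lo j < x j} ∩ {x | x j < hi j}) := by
    ext x; simp [openBox]
  rw [this]
  exact isOpen_iInter_of_finite fun j => (isOpen_lt continuous_const (by fun_prop)).inter
    (isOpen_lt (by fun_prop) continuous_const)

theorem closure_interior_closedBox {n : ℕ} {lo hi : Fin n → ℝ} (h : ∀ j, lo j < hi j) :
    closedBox lo hi = closure (interior (closedBox lo hi)) := by
  have hconv : Convex ℝ (closedBox lo hi) := by
    intro x hx y hy s t hs ht hst j
    have hx' := hx j
    have hy' := hy j
    simp only [PiLp.add_apply, PiLp.smul_apply, smul_eq_mul]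
    have h1 : t = 1 - s := by linarith
    subst h1
    constructor <;> nlinarith
  have hne : (interior (closedBox lo hi)).Nonempty := by
    refine ⟨WithLp.toLp 2 fun j => (lo j + hi j) / 2, openBox_subset_interior lo hi fun j => ?_⟩
    have := h j
    simp only
    constructor <;> linarith
  rw [hconv.closure_interior_eq_closure_of_nonempty_interior hne,
    (isClosed_closedBox lo hi).closure_eq]

theorem frontier_closedBox_subset {n : ℕ} (lo hi : Fin n → ℝ) :
    frontier (closedBox lo hi) ⊆ ⋃ j, ({x | x j = lo j} ∪ {x | x j = hi j}) := by
  rintro x ⟨hx, hx'⟩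
  rw [(isClosed_closedBox lo hi).closure_eq] at hx
  by_contra hne
  simp only [mem_iUnion, not_exists, mem_union, mem_ofPred_eq, not_or] at hne
  exact hx' (openBox_subset_interior lo hi fun j =>
    ⟨(hx j).1.lt_of_ne' (hne j).1, (hx j).2.lt_of_ne (hne j).2⟩)

/-- If the conjecture holds, the lower density of the primes whose normalized local roots lie in a
half-open box is at least the relative volume of the box. -/
theorem eventually_lt_splSetOf_box {n : ℕ} (hn : 0 < n) {f : ℤ[X]} (hf : f.Monic) {α : Fin n → ℂ}
    (hα : f.map (Int.castRingHom ℂ) = ∏ i, (X - C (α i))) (hrel : ¬ HasNontrivialRel α)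
    (hconj : EquidistributionConjecture f α)
    (hfin : relVol α (domain α 1) ≠ ⊤)
    (hnull : ∀ j c, relVol α ({x | x j = c} ∩ domain α 1) = 0)
    {lo u : Fin n → ℝ} (h0 : ∀ j, 0 ≤ lo j) (h : ∀ j, lo j < u j) (h1 : ∀ j, u j ≤ 1) {c : ℝ}
    (hc : c < (relVol α).real (box lo u ∩ domain α 1) / (relVol α).real (domain α 1)) :
    ∀ᶠ X : ℝ in atTop, c < ((splSetOf n f X fun p r => rootPoint p r ∈ box lo u).ncard : ℝ) /
      ((Spl n f X).ncard : ℝ) := by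
  -- The closed boxes `[lo, hi m]` increase to `[lo, u)`. The denominator `m + 2` keeps them
  -- nondegenerate already at `m = 0`.
  let hi : ℕ → Fin n → ℝ := fun m j => u j - (u j - lo j) / (m + 2)
  have hhi : ∀ m j, lo j < hi m j ∧ hi m j < u j := by
    intro m j
    have hd : 0 < u j - lo j := sub_pos.2 (h j)
    have h2 : (u j - lo j) / ((m : ℝ) + 2) < u j - lo j := div_lt_self hd (by
      have : (0 : ℝ) ≤ m := m.cast_nonneg
      linarith)
    have h3 : 0 < (u j - lo j) / ((m : ℝ) + 2) := by positivity
    constructor <;> simp only [hi] <;> linarith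
  let D : ℕ → Set (EuclideanSpace ℝ (Fin n)) := fun m => closedBox lo (hi m)
  have hDmono : Monotone fun m => D m ∩ domain α 1 := by
    intro m m' hm
    refine inter_subset_inter_left _ fun x hx j => ⟨(hx j).1, (hx j).2.trans ?_⟩
    have hd : 0 ≤ u j - lo j := (sub_pos.2 (h j)).le
    simp only [hi]
    gcongr
  have hDunion : ⋃ m, D m ∩ domain α 1 = box lo u ∩ domain α 1 := by
    rw [← iUnion_inter]
    congr 1
    ext x
    simp only [mem_iUnion]
    constructor
    · rintro ⟨m, hx⟩ j
      exact ⟨(hx j).1, (hx j).2.trans_lt (hhi m j).2⟩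
    · intro hx
      have : ∀ᶠ m : ℕ in atTop, ∀ j, x j ≤ hi m j := by
        rw [eventually_all]
        intro j
        have ht : Tendsto (fun m : ℕ => hi m j) atTop (𝓝 (u j - 0)) :=
          tendsto_const_nhds.sub (Tendsto.div_atTop tendsto_const_nhds
            (tendsto_atTop_add_const_right _ _ tendsto_natCast_atTop_atTop))
        rw [sub_zero] at ht
        exact (ht.eventually_const_lt (hx j).2).mono fun _ => le_of_lt
      obtain ⟨m, hm⟩ := this.exists
      exact ⟨m, fun j => ⟨(hx j).1, hm j⟩⟩
  have htend : Tendsto (fun m => (relVol α).real (D m ∩ domain α 1) /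
      (relVol α).real (domain α 1)) atTop
      (𝓝 ((relVol α).real (box lo u ∩ domain α 1) / (relVol α).real (domain α 1))) := by
    refine Tendsto.div_const ?_ _
    rw [← hDunion]
    refine (ENNReal.tendsto_toReal ?_).comp (tendsto_measure_iUnion_atTop hDmono)
    exact measure_ne_top_of_subset (iUnion_subset fun m => inter_subset_right) hfin
  obtain ⟨m, hm⟩ := (htend.eventually_const_lt hc).exists
  have hfront : relVol α (frontier (D m) ∩ domain α 1) = 0 := by
    refine measure_mono_null (inter_subset_inter_left _ (frontier_closedBox_subset lo (hi m))) ?_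
    rw [iUnion_inter]
    refine measure_iUnion_null fun j => ?_
    rw [union_inter_distrib_right]
    exact measure_union_null (hnull j _) (hnull j _)
  have hlim := hconj 1 (prPos_one hn hf hα hrel) (D m)
    (closure_interior_closedBox fun j => (hhi m j).1)
    (fun x hx j => ⟨(h0 j).trans (hx j).1, (hx j).2.trans_lt ((hhi m j).2.trans_le (h1 j))⟩) hfront
  filter_upwards [hlim.eventually_const_lt hm] with X hX
  rw [splPermIn_one_eq hn hf hα hrel, splPerm_one_eq hn hf hα hrel] at hX
  refine hX.trans_le ?_
  gcongr
  · exact splSetOf_finite _ _ _ _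
  · exact splSetOf_mono f X fun p r _ _ hr j => ⟨(hr j).1, (hr j).2.trans_lt (hhi m j).2⟩

/-- If the conjecture holds, the primes with `rᵢ / p < a` have the expected density. -/
theorem tendsto_splRootLt {n : ℕ} {f : ℤ[X]} (hf : f.Monic) {α : Fin n → ℂ}
    (hα : f.map (Int.castRingHom ℂ) = ∏ i, (X - C (α i))) (hrel : ¬ HasNontrivialRel α)
    (hconj : EquidistributionConjecture f α) (hmeas : MeasurableSet (domain α 1))
    (hpos : relVol α (domain α 1) ≠ 0) (hfin : relVol α (domain α 1) ≠ ⊤)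
    (hnull : ∀ j c, relVol α ({x | x j = c} ∩ domain α 1) = 0)
    (i : Fin n) {a : ℝ} (ha0 : 0 ≤ a) (ha1 : a < 1) :
    Tendsto (fun X : ℝ => ((SplRootLt n f i a X).ncard : ℝ) / ((Spl n f X).ncard : ℝ)) atTop
      (𝓝 ((relVol α).real ({x | x i < a} ∩ box 0 1 ∩ domain α 1) /
        (relVol α).real (domain α 1))) := by
  have hn : 0 < n := i.pos
  have hposR : 0 < (relVol α).real (domain α 1) := ENNReal.toReal_pos hpos hfin
  refine tendsto_order.2 ⟨fun c hc => ?_, fun c hc => ?_⟩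
  -- For `a = 0` the box is degenerate, but its volume is `0` and the lower bound is trivial.
  · rcases ha0.eq_or_lt with rfl | ha
    · have : {x : EuclideanSpace ℝ (Fin n) | x i < 0} ∩ box 0 1 = ∅ :=
        Set.eq_empty_of_forall_notMem fun x hx => absurd hx.1 (not_lt.2 (hx.2 i).1)
      rw [this, empty_inter, measureReal_empty, zero_div] at hc
      exact Eventually.of_forall fun X => hc.trans_le (by positivity)
    · have hset : {x : EuclideanSpace ℝ (Fin n) | x i < a} ∩ box 0 1 =
          box 0 (Function.update 1 i a) := by
        ext x
        simp only [box, mem_inter_iff, mem_ofPred_eq, Pi.zero_apply, Pi.one_apply]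
        constructor
        · rintro ⟨hx, hx'⟩ j
          rcases eq_or_ne j i with rfl | hj
          · simpa using ⟨(hx' j).1, hx⟩
          · simpa [hj] using hx' j
        · intro hx
          have hxi : x i < a := by simpa using (hx i).2
          refine ⟨hxi, fun j => ⟨(hx j).1, ?_⟩⟩
          rcases eq_or_ne j i with rfl | hj
          · exact hxi.trans ha1
          · simpa [hj] using (hx j).2
      rw [hset] at hc
      have := eventually_lt_splSetOf_box hn hf hα hrel hconj hfin hnull (fun _ => le_rfl)
        (fun j => ?_) (fun j => ?_) hc
      · filter_upwards [this] with X hX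
        refine hX.trans_le ?_
        gcongr
        · exact splSetOf_finite _ _ _ _
        · exact splSetOf_mono f X fun p r _ _ hr => by simpa [rootPoint] using (hr i).2
      · rcases eq_or_ne j i with rfl | hj
        · simpa using ha
        · simp [hj]
      · rcases eq_or_ne j i with rfl | hj
        · simpa using ha1.le
        · simp [hj]
  -- The upper bound comes from the lower bound for the complementary box `xᵢ ≥ a`. The two boxes
  -- fill the domain up to the null faces `xⱼ = 1`, while the two sets of primes are disjoint.
  · have hadd : (relVol α).real ({x | x i < a} ∩ box 0 1 ∩ domain α 1) +
        (relVol α).real (box (Function.update 0 i a) 1 ∩ domain α 1) =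
        (relVol α).real (domain α 1) := by
      have hfin' : ∀ B, relVol α (B ∩ domain α 1) ≠ ⊤ := fun B =>
        measure_ne_top_of_subset inter_subset_right hfin
      have hdisj : Disjoint ({x | x i < a} ∩ box 0 1 ∩ domain α 1)
          (box (Function.update 0 i a) 1 ∩ domain α 1) := by
        refine Set.disjoint_left.2 fun x hx hy => ?_
        have hxi : x i < a := hx.1.1
        have hyi : a ≤ x i := by simpa using (hy.1 i).1
        exact hxi.not_ge hyi
      rw [← measureReal_union hdisj ((measurableSet_box _ _).inter hmeas) (hfin' _) (hfin' _)]
      refine congrArg ENNReal.toReal (measure_eq_measure_of_null_sdiff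
        (union_subset inter_subset_right inter_subset_right) ?_)
      refine measure_mono_null (t := ⋃ j, ({x | x j = 1} ∩ domain α 1)) ?_
        (measure_iUnion_null fun j => hnull j 1)
      rintro x ⟨hx, hx'⟩
      rw [mem_iUnion]
      by_contra hne
      simp only [mem_inter_iff, mem_ofPred_eq, hx, and_true, not_exists] at hne
      have hlt : ∀ j, x j < 1 := fun j => (hx.1 j).2.lt_of_ne (hne j)
      refine hx' ?_
      by_cases hxi : x i < a
      · exact Or.inl ⟨⟨hxi, fun j => ⟨(hx.1 j).1, hlt j⟩⟩, hx⟩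
      · refine Or.inr ⟨fun j => ⟨?_, hlt j⟩, hx⟩
        rcases eq_or_ne j i with rfl | hj
        · simpa using hxi
        · simpa [hj] using (hx.1 j).1
    have hc' : 1 - c < (relVol α).real (box (Function.update 0 i a) 1 ∩ domain α 1) /
        (relVol α).real (domain α 1) := by
      change _ < c at hc
      rw [div_lt_iff₀ hposR] at hc
      rw [lt_div_iff₀ hposR]
      linarith
    have := eventually_lt_splSetOf_box (u := 1) hn hf hα hrel hconj hfin hnull (fun j => ?_)
        (fun j => ?_) (fun j => le_rfl) hc'
    · filter_upwards [this, eventually_spl_ncard_pos hf hα] with X hX hpos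
      have hdisj : Disjoint (SplRootLt n f i a X)
          (splSetOf n f X fun p r => rootPoint p r ∈ box (Function.update 0 i a) 1) :=
        splSetOf_disjoint f X fun p r hr hr' => by
          have := (hr' i).1
          simp only [Function.update_self, rootPoint] at this
          exact absurd hr (not_lt.2 this)
      have hle := Set.ncard_le_ncard (union_subset
        (splSetOf_mono f X (Q := fun _ _ => True) fun _ _ _ _ _ => trivial)
        (splSetOf_mono f X (Q := fun _ _ => True) fun _ _ _ _ _ => trivial))
        (splSetOf_finite n f X _) (s := SplRootLt n f i a X ∪
          (splSetOf n f X fun p r => rootPoint p r ∈ box (Function.update 0 i a) 1))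
      rw [Set.ncard_union_eq hdisj (splSetOf_finite ..) (splSetOf_finite ..)] at hle
      have hposX : (0 : ℝ) < (Spl n f X).ncard := by exact_mod_cast hpos
      have hle' : ((SplRootLt n f i a X).ncard : ℝ) +
          ((splSetOf n f X fun p r => rootPoint p r ∈ box (Function.update 0 i a) 1).ncard : ℝ) ≤
          (Spl n f X).ncard := by exact_mod_cast hle
      rw [lt_div_iff₀ hposX] at hX
      rw [div_lt_iff₀ hposX]
      linarith
    · rcases eq_or_ne j i with rfl | hj
      · simpa using ha0
      · simp [hj]
    · rcases eq_or_ne j i with rfl | hj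
      · simpa using ha1
      · simp [hj]

end LocalRoots

/-! ### Evaluation of the volume ratio and conclusion. -/

namespace LocalRoots

open MeasureTheory Set Polynomial

/-- With `t = 1` the dimension `n - t` is `N`, and the relations only require an integral coordinate
sum. -/
theorem relVol_inter_domain {N : ℕ} {α : Fin (N + 1) → ℂ} {S : ℤ} (hS : ∑ i, α i = S)
    (hrel : ¬ HasNontrivialRel α) (B : Set (EuclideanSpace ℝ (Fin (N + 1)))) :
    relVol α (B ∩ domain α 1) =
      sumMeasure N (B ∩ (closedBox 0 1 ∩ sortedPoints (N + 1))) := by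
  rw [sumMeasure, Measure.restrict_apply' (measurableSet_integralSum N), relVol,
    relDim_eq_one N.succ_pos hS hrel, domain_one_eq N.succ_pos hS hrel, Nat.add_sub_cancel]
  congr 1
  ext x
  simp only [mem_inter_iff, mem_ofPred_eq, closedBox, sortedPoints, Pi.zero_apply, Pi.one_apply,
    and_assoc]

theorem measurableSet_domain_one {N : ℕ} {α : Fin (N + 1) → ℂ} {S : ℤ} (hS : ∑ i, α i = S)
    (hrel : ¬ HasNontrivialRel α) : MeasurableSet (domain α 1) := by
  rw [domain_one_eq N.succ_pos hS hrel]
  convert (((isClosed_closedBox 0 1).measurableSet.inter (measurableSet_sortedPoints (N + 1))).inter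
    (measurableSet_integralSum N)) using 1
  ext x
  simp only [mem_inter_iff, mem_ofPred_eq, closedBox, sortedPoints, Pi.zero_apply, Pi.one_apply,
    and_assoc]

theorem sumMeasure_closedBox_inter_sorted {N : ℕ} (hN : 1 ≤ N) :
    sumMeasure N (closedBox 0 1 ∩ sortedPoints (N + 1)) =
      sumMeasure N (box 0 1 ∩ sortedPoints (N + 1)) := by
  refine (measure_eq_measure_of_null_sdiff
    (inter_subset_inter_left _ fun x hx j => ⟨(hx j).1, (hx j).2.le⟩) ?_).symm
  refine measure_mono_null (t := ⋃ j, {x | x j = 1}) ?_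
    (measure_iUnion_null fun j => sumMeasure_coord_eq hN j 1)
  rintro x ⟨⟨hx, hs⟩, hx'⟩
  rw [mem_iUnion]
  by_contra hne
  simp only [mem_ofPred_eq, not_exists] at hne
  exact hx' ⟨fun j => ⟨(hx j).1, (hx j).2.lt_of_ne (hne j)⟩, hs⟩

theorem factorial_mul_sumMeasure_real {N k : ℕ} {a : ℝ} (ha0 : 0 ≤ a) (ha1 : a ≤ 1) :
    (sumMeasure N).real (lowCoords (N + 1) k a) = ((N + 1).factorial : ℝ) *
      (sumMeasure N).real (lowCoords (N + 1) k a ∩ sortedPoints (N + 1)) := by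
  simp [Measure.real, sumMeasure_eq_factorial_mul (measurableSet_lowCoords ha0 ha1)
    permute_mem_lowCoords]

/-- The density of the primes with `rᵢ / p < a` under the equidistribution conjecture. -/
theorem relVol_real_ratio {N : ℕ} (hN : 1 ≤ N) {α : Fin (N + 1) → ℂ} {S : ℤ} (hS : ∑ i, α i = S)
    (hrel : ¬ HasNontrivialRel α) (i : Fin (N + 1)) {a : ℝ} (ha0 : 0 ≤ a) (ha1 : a ≤ 1) :
    relVol α (domain α 1) ≠ 0 ∧ relVol α (domain α 1) ≠ ⊤ ∧
    (relVol α).real ({x | x i < a} ∩ box 0 1 ∩ domain α 1) / (relVol α).real (domain α 1) =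
      ∑ l ∈ Finset.Icc (i + 1 : ℕ) (N + 1),
        ((N + 1).choose l : ℝ) * sectionVolume N l (N + 1 - l) a := by
  -- With `k = 0` the set `lowCoords` is the whole unit box, so the symmetrization used for the
  -- numerator also gives the denominator.
  have htot : relVol α (domain α 1) = sumMeasure N (lowCoords (N + 1) 0 a ∩ sortedPoints (N + 1)) := by
    rw [lowCoords_zero, ← sumMeasure_closedBox_inter_sorted hN]
    simpa using relVol_inter_domain hS hrel univ
  have hfac := sumMeasure_eq_factorial_mul (N := N) (measurableSet_lowCoords ha0 ha1)
    (permute_mem_lowCoords (k := 0))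
  rw [← htot, lowCoords_zero, sumMeasure_unitBox] at hfac
  have hP := ENNReal.ofReal_pos.2 (paramFactor_pos N)
  have h0 : relVol α (domain α 1) ≠ 0 := fun h => by simp [h, (paramFactor_pos N).not_ge] at hfac
  have htop : relVol α (domain α 1) ≠ ⊤ := fun h => by
    rw [h, ENNReal.mul_top (by exact_mod_cast (Nat.factorial_ne_zero _))] at hfac
    exact ENNReal.ofReal_ne_top hfac
  refine ⟨h0, htop, ?_⟩
  have hnum : relVol α ({x | x i < a} ∩ box 0 1 ∩ domain α 1) =
      sumMeasure N (lowCoords (N + 1) (i + 1) a ∩ sortedPoints (N + 1)) := by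
    rw [relVol_inter_domain hS hrel, lowCoords_inter_sortedPoints]
    congr 1
    ext x
    simp only [mem_inter_iff, and_assoc, and_congr_right_iff]
    intro _ hx
    exact and_iff_right fun j => ⟨(hx j).1, (hx j).2.le⟩
  have h1 := factorial_mul_sumMeasure_real (N := N) (k := i + 1) ha0 ha1
  rw [sumMeasure_real_lowCoords hN ha0 ha1] at h1
  have h2 := congrArg ENNReal.toReal hfac
  rw [ENNReal.toReal_ofReal (paramFactor_pos N).le, ENNReal.toReal_mul, ENNReal.toReal_natCast] at h2
  have hf0 : ((N + 1).factorial : ℝ) ≠ 0 := by positivity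
  have hT : 0 < (relVol α).real (domain α 1) := ENNReal.toReal_pos h0 htop
  -- Multiplied by `(N + 1)!`, the denominator becomes `paramFactor N` and the numerator
  -- `paramFactor N` times the sum.
  rw [div_eq_iff hT.ne']
  refine mul_left_cancel₀ hf0 ?_
  rw [Measure.real, hnum, ← Measure.real, ← h1, h2, ← Measure.real]
  ring

end LocalRoots

/-- The local roots are indexed from `0`, so `i : Fin n` stands for the `(i + 1)`-st local root. -/
theorem theorem5p1 (n : ℕ) (hn : 1 < n) (f : Polynomial ℤ) (hf : f.Monic)
    (hdeg : f.natDegree = n) (α : Fin n → ℂ)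
    (hα : f.map (Int.castRingHom ℂ) = ∏ i, (Polynomial.X - Polynomial.C (α i)))
    (hrel : ¬ LocalRoots.HasNontrivialRel α)
    (hconj : LocalRoots.EquidistributionConjecture f α)
    (i : Fin n) (a : ℝ) (ha0 : 0 ≤ a) (ha1 : a < 1) :
    ∃ L : ℝ,
      Filter.Tendsto
        (fun X : ℝ => ((LocalRoots.SplRootLt n f i a X).ncard : ℝ) /
          ((LocalRoots.Spl n f X).ncard : ℝ))
        Filter.atTop (nhds L) ∧
      ((n - 1).factorial : ℝ) * L = LocalRoots.rootSum n ((i : ℕ) + 1) a := by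
  obtain ⟨N, rfl⟩ := Nat.exists_eq_add_of_le' hn.le
  have hN : 1 ≤ N := by omega
  have hS := LocalRoots.sum_roots_eq hf hα
  obtain ⟨h0, htop, hratio⟩ := LocalRoots.relVol_real_ratio hN hS hrel i ha0 ha1.le
  refine ⟨_, LocalRoots.tendsto_splRootLt hf hα hrel hconj
    (LocalRoots.measurableSet_domain_one hS hrel) h0 htop (fun j c => ?_) i ha0 ha1, ?_⟩
  · rw [LocalRoots.relVol_inter_domain hS hrel]
    exact MeasureTheory.measure_mono_null Set.inter_subset_left
      (LocalRoots.sumMeasure_coord_eq hN j c)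
  · rw [hratio, LocalRoots.rootSum_eq hN ha0, Nat.add_sub_cancel]
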